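/- Let $\mathrm{PL}_0(\mathbf I)$ be the group of orientation-preserving piecewise-linear homeomorphisms of $\mathbf I=[0,1]$ with only finitely many points of non-differentiability. We write $tf$ for $f(t)$, and products of homeomorphisms are read from left to right. Let $F\le \mathrm{PL}_0(\mathbf I)$ be Thompson's group, i.e. the subgroup of all elements whose points of non-differentiability are dyadic rationals and whose slopes are integral powers of $2$. Its standard generators are $$tx_0=\begin{cases}2t & 0\le t\le \frac14\\ t+\frac14 & \frac14\le t\le\frac12\\ \frac t2+\frac12 & \frac12\le t\le 1,\end{cases}\qquad tx_1=\begin{cases}t & 0\le t\le\frac12\\ 2t-\frac12 & \frac12\le t\le\frac58\\ t+\frac18 & \frac58\le t\le\frac34\\ \frac t2+\frac12 & \frac34\le t\le 1.\end{cases}$$ An orbital of $f\in \mathrm{PL}_0(\mathbf I)$ is one of the finitely many disjoint open intervals whose union is the support $\{t: tf\neq t\}$. An orbital $A$ of $f$ is an up-bump if $tf>t$ for all $t\in A$, and a down-bump if $tf<t$ for all $t\in A$. Let $f_0,f_1\in \mathrm{PL}_0(\mathbf I)$ be non-commuting, and suppose that for every orbital $A$ of $f_0$ and every orbital $B$ of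 $f_1$ either $B\subseteq A$ or $A\cap B=\emptyset$. Suppose further that for every orbital $(a,c)$ of $f_0$ there is at least one orbital of $f_1$ properly contained in $(a,c)$, and, writing $(b_1,d_1),\dots,(b_n,d_n)$ for all orbitals of $f_1$ properly contained in $(a,c)$, in increasing order, the following holds. If $(a,c)$ is an up-bump of $f_0$, then: (i) $a<b_1$; (ii) there is a point $p<c$ with $f_0|_{[p,c]}=f_1|_{[p,c]}$; (iii) $d_n=c$; (iv) if $p$ is the minimal point with $f_0|_{[p,c]}=f_1|_{[p,c]}$, then $b_nf_0\ge p$; (v) $b_1f_0>b_n$; and, with $p$ as in (iv), $b_1f_0\ge p$. If $(a,c)$ is a down-bump of $f_0$, then: (i) $d_n<c$; (ii) there is a point $\rho>a$ with $f_0|_{[a,\rho]}=f_1|_{[a,\rho]}$; (iii) $b_1=a$; (iv) if $\rho$ is the maximal point with $f_0|_{[a,\rho]}=f_1|_{[a,\rho]}$, then $d_1f_0\le\rho$; (v) $d_nf_0<d_1$; and, with $\rho$ as in (iv), $d_nf_0\le\rho$. Then $f_0$ and $f_1$ generate a standard isomorphic copy of $F$: there is an isomorphism from $F$ onto the subgroup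 $\langle f_0,f_1\rangle$ of $\mathrm{PL}_0(\mathbf I)$ that sends $x_0$ to $f_0$ and $x_1$ to $f_1$. -/

import Mathlib

open Set

/-- The self-map `f` of the unit interval is affine, with slope in `M`, on every
nondegenerate closed subinterval whose interior contains no point of `S`. -/
def AffineOff (S : Set unitInterval) (M : Set ℝ) (f : unitInterval → unitInterval) : Prop :=
  ∀ x y : unitInterval, x < y → (∀ s ∈ S, ¬ (x < s ∧ s < y)) →
    ∃ m ∈ M, ∀ z : unitInterval, x ≤ z → z ≤ y → (f z : ℝ) = f x + m * ((z : ℝ) - x)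

theorem AffineOff.comp {S T : Set unitInterval} {M N P : Set ℝ}
    {f g : unitInterval ≃ₜ unitInterval} (hg : StrictMono g)
    (hf' : AffineOff S M f) (hg' : AffineOff T N g)
    (hP : ∀ m ∈ M, ∀ k ∈ N, m * k ∈ P) :
    AffineOff (T ∪ g ⁻¹' S) P (f * g : unitInterval ≃ₜ unitInterval) := by
  intro x y hxy hs
  obtain ⟨k, hk, hk'⟩ := hg' x y hxy (fun s h => hs s (Or.inl h))
  obtain ⟨m, hm, hm'⟩ := hf' (g x) (g y) (hg hxy) (by
    rintro s h ⟨h1, h2⟩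
    refine hs (g.symm s) (Or.inr (by simpa using h)) ⟨?_, ?_⟩
    · rw [← hg.lt_iff_lt]; simpa using h1
    · rw [← hg.lt_iff_lt]; simpa using h2)
  refine ⟨m * k, hP m hm k hk, fun z h1 h2 => ?_⟩
  have e1 := hm' (g z) (hg.monotone h1) (hg.monotone h2)
  have e2 := hk' z h1 h2
  change ((f (g z) : unitInterval) : ℝ) = (f (g x) : unitInterval) + _
  rw [e1, e2]; ring

theorem strictMono_homeomorph_inv {f : unitInterval ≃ₜ unitInterval} (hf : StrictMono f) :
    StrictMono (f⁻¹ : unitInterval ≃ₜ unitInterval) := by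
  intro x y hxy
  change f.symm x < f.symm y
  rw [← hf.lt_iff_lt]; simpa using hxy

theorem AffineOff.inv {S : Set unitInterval} {M P : Set ℝ}
    {f : unitInterval ≃ₜ unitInterval} (hf : StrictMono f)
    (hf' : AffineOff S M f) (hP : ∀ m ∈ M, m⁻¹ ∈ P) :
    AffineOff (f '' S) P (f⁻¹ : unitInterval ≃ₜ unitInterval) := by
  intro x y hxy hs
  have hmono := strictMono_homeomorph_inv hf
  obtain ⟨m, hm, hm'⟩ := hf' (f.symm x) (f.symm y) (hmono hxy) (by
    rintro s h ⟨h1, h2⟩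
    refine hs (f s) ⟨s, h, rfl⟩ ⟨?_, ?_⟩
    · simpa using hf h1
    · simpa using hf h2)
  have hm0 : m ≠ 0 := by
    rintro rfl
    have := hm' (f.symm y) (hmono hxy).le le_rfl
    simp only [Homeomorph.apply_symm_apply, zero_mul, add_zero] at this
    exact hxy.ne' (Subtype.ext this)
  refine ⟨m⁻¹, hP m hm, fun z h1 h2 => ?_⟩
  have e1 := hm' (f.symm z) (hmono.monotone h1) (hmono.monotone h2)
  simp only [Homeomorph.apply_symm_apply] at e1
  change ((f.symm z : unitInterval) : ℝ) = (f.symm x : unitInterval) + _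
  rw [e1]; field_simp; ring

/-- `PL₀(I)`: the group of orientation-preserving homeomorphisms of `[0,1]` that are piecewise
linear with finitely many breakpoints. -/
def PL0 : Subgroup (unitInterval ≃ₜ unitInterval) where
  carrier := {f | StrictMono f ∧ ∃ S : Set unitInterval, S.Finite ∧ AffineOff S univ f}
  mul_mem' := by
    rintro f g ⟨hf, S, hS, hf'⟩ ⟨hg, T, hT, hg'⟩
    exact ⟨hf.comp hg, _, hT.union (hS.preimage g.injective.injOn),
      hf'.comp hg hg' (fun _ _ _ _ => mem_univ _)⟩
  one_mem' := ⟨strictMono_id, ∅, finite_empty, fun x y _ _ =>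
    ⟨1, mem_univ _, fun z _ _ => by simp⟩⟩
  inv_mem' := by
    rintro f ⟨hf, S, hS, hf'⟩
    exact ⟨strictMono_homeomorph_inv hf, _, hS.image f, hf'.inv hf (fun _ _ => mem_univ _)⟩

/-- `r` is a dyadic rational. -/
def IsDyadic (r : ℝ) : Prop := ∃ (m : ℤ) (n : ℕ), r = (m : ℝ) / 2 ^ n

/-- The integral powers of two. -/
def powersOfTwo : Set ℝ := range fun k : ℤ => (2 : ℝ) ^ k

theorem IsDyadic.add {r s : ℝ} (hr : IsDyadic r) (hs : IsDyadic s) : IsDyadic (r + s) := by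
  obtain ⟨m, n, rfl⟩ := hr
  obtain ⟨m', n', rfl⟩ := hs
  refine ⟨m * 2 ^ n' + m' * 2 ^ n, n + n', ?_⟩
  push_cast
  field_simp
  rw [pow_add]
  ring

theorem IsDyadic.neg {r : ℝ} (hr : IsDyadic r) : IsDyadic (-r) := by
  obtain ⟨m, n, rfl⟩ := hr
  exact ⟨-m, n, by push_cast; ring⟩

theorem IsDyadic.sub {r s : ℝ} (hr : IsDyadic r) (hs : IsDyadic s) : IsDyadic (r - s) := by
  rw [sub_eq_add_neg]; exact hr.add hs.neg

theorem IsDyadic.zpow_mul {r : ℝ} (hr : IsDyadic r) (k : ℤ) : IsDyadic ((2 : ℝ) ^ k * r) := by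
  obtain ⟨m, n, rfl⟩ := hr
  obtain ⟨k, rfl | rfl⟩ := k.eq_nat_or_neg
  · exact ⟨2 ^ k * m, n, by push_cast; rw [zpow_natCast]; ring⟩
  · refine ⟨m, n + k, ?_⟩
    rw [zpow_neg, zpow_natCast, pow_add]; field_simp

theorem isDyadic_zero : IsDyadic 0 := ⟨0, 0, by simp⟩

theorem strictMono_homeomorph_zero {f : unitInterval ≃ₜ unitInterval} (hf : StrictMono f) :
    f 0 = 0 := by
  apply le_antisymm _ (unitInterval.nonneg' )
  have := hf.monotone (unitInterval.nonneg' : 0 ≤ f.symm 0)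
  simpa using this

theorem isDyadic_apply_iff {S : Set unitInterval} (hS : S.Finite)
    (hSd : ∀ s ∈ S, IsDyadic (s : ℝ)) {f : unitInterval ≃ₜ unitInterval} (hf : StrictMono f)
    (hf' : AffineOff S powersOfTwo f) (x : unitInterval) :
    IsDyadic (f x : ℝ) ↔ IsDyadic (x : ℝ) := by
  have hT : (insert 0 S).Finite := hS.insert 0
  have hTd : ∀ s ∈ insert 0 S, IsDyadic (s : ℝ) := by
    rintro s (rfl | h)
    · simpa using isDyadic_zero
    · exact hSd s h
  induction hn : (insert 0 S ∩ Iio x).ncard using Nat.strong_induction_on generalizing x with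
  | _ n ih =>
    rcases eq_or_lt_of_le (unitInterval.nonneg' : 0 ≤ x) with rfl | hx
    · rw [strictMono_homeomorph_zero hf]
    · have hfin : (insert 0 S ∩ Iio x).Finite := hT.inter_of_left _
      obtain ⟨t, ⟨htT, htx⟩, hmax⟩ := exists_max_image (insert 0 S ∩ Iio x) id hfin
        ⟨0, mem_insert _ _, hx⟩
      have hft : IsDyadic (f t : ℝ) := by
        refine (ih _ ?_ t rfl).2 (hTd t htT)
        rw [← hn]
        refine ncard_lt_ncard ⟨fun s hs => ⟨hs.1, lt_trans (mem_Iio.1 hs.2) htx⟩, fun h => ?_⟩ hfin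
        exact lt_irrefl t (h ⟨htT, htx⟩).2
      obtain ⟨_, ⟨k, rfl⟩, hk⟩ := hf' t x htx
        (fun s hs h => not_le.2 h.1 (hmax s ⟨Or.inr hs, h.2⟩))
      have e := hk x htx.le le_rfl
      simp only at e
      constructor
      · intro h
        have h2 := (hTd t htT).add ((h.sub hft).zpow_mul (-k))
        have e2 : (x : ℝ) = (t : ℝ) + (2 : ℝ) ^ (-k) * ((f x : ℝ) - f t) := by
          rw [e, zpow_neg]; field_simp; ring
        rwa [← e2] at h2
      · intro h
        rw [e]
        exact hft.add ((h.sub (hTd t htT)).zpow_mul k)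

/-- Thompson's group `F`: the elements of `PL₀(I)` whose breakpoints are dyadic rationals and whose
slopes are integral powers of two. -/
def ThompsonF : Subgroup PL0 where
  carrier := {f | ∃ S : Set unitInterval, S.Finite ∧ (∀ s ∈ S, IsDyadic (s : ℝ)) ∧
    AffineOff S powersOfTwo f.1}
  mul_mem' := by
    rintro f g ⟨S, hS, hSd, hf'⟩ ⟨T, hT, hTd, hg'⟩
    refine ⟨_, hT.union (hS.preimage g.1.injective.injOn), ?_,
      hf'.comp g.2.1 hg' ?_⟩
    · rintro s (h | h)
      · exact hTd s h
      · exact (isDyadic_apply_iff hT hTd g.2.1 hg' s).1 (hSd _ h)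
    · rintro _ ⟨k, rfl⟩ _ ⟨l, rfl⟩
      exact ⟨k + l, zpow_add₀ two_ne_zero k l⟩
  one_mem' := ⟨∅, finite_empty, by simp, fun x y _ _ =>
    ⟨1, ⟨0, by simp⟩, fun z _ _ => by simp⟩⟩
  inv_mem' := by
    rintro f ⟨S, hS, hSd, hf'⟩
    refine ⟨_, hS.image f.1, ?_, hf'.inv f.2.1 ?_⟩
    · rintro _ ⟨s, h, rfl⟩
      exact (isDyadic_apply_iff hS hSd f.2.1 hf' s).2 (hSd s h)
    · rintro _ ⟨k, rfl⟩
      exact ⟨-k, zpow_neg _ _⟩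

/-- The order automorphism of `[0,1]` underlying the first standard generator of `F`. -/
noncomputable def x0OrderIso : unitInterval ≃o unitInterval :=
    { toFun := fun t => ⟨if (t : ℝ) ≤ 1 / 4 then 2 * (t : ℝ) else
        if (t : ℝ) ≤ 1 / 2 then (t : ℝ) + 1 / 4 else (t : ℝ) / 2 + 1 / 2, by
          have h0 := t.2.1
          have h1 := t.2.2
          constructor <;> split_ifs <;> linarith⟩
      invFun := fun t => ⟨if (t : ℝ) ≤ 1 / 2 then (t : ℝ) / 2 else
        if (t : ℝ) ≤ 3 / 4 then (t : ℝ) - 1 / 4 else 2 * (t : ℝ) - 1, by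
          have h0 := t.2.1
          have h1 := t.2.2
          constructor <;> split_ifs <;> linarith⟩
      left_inv := fun t => Subtype.ext (by dsimp only; split_ifs <;> linarith)
      right_inv := fun t => Subtype.ext (by dsimp only; split_ifs <;> linarith)
      map_rel_iff' := fun {s t} => by
        simp only [Equiv.coe_fn_mk, ← Subtype.coe_le_coe]
        split_ifs <;> constructor <;> intro h <;> linarith }

/-- The order automorphism of `[0,1]` underlying the second standard generator of `F`. -/
noncomputable def x1OrderIso : unitInterval ≃o unitInterval :=
    { toFun := fun t => ⟨if (t : ℝ) ≤ 1 / 2 then (t : ℝ) else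
        if (t : ℝ) ≤ 5 / 8 then 2 * (t : ℝ) - 1 / 2 else
        if (t : ℝ) ≤ 3 / 4 then (t : ℝ) + 1 / 8 else (t : ℝ) / 2 + 1 / 2, by
          have h0 := t.2.1
          have h1 := t.2.2
          constructor <;> split_ifs <;> linarith⟩
      invFun := fun t => ⟨if (t : ℝ) ≤ 1 / 2 then (t : ℝ) else
        if (t : ℝ) ≤ 3 / 4 then (t : ℝ) / 2 + 1 / 4 else
        if (t : ℝ) ≤ 7 / 8 then (t : ℝ) - 1 / 8 else 2 * (t : ℝ) - 1, by
          have h0 := t.2.1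
          have h1 := t.2.2
          constructor <;> split_ifs <;> linarith⟩
      left_inv := fun t => Subtype.ext (by dsimp only; split_ifs <;> linarith)
      right_inv := fun t => Subtype.ext (by dsimp only; split_ifs <;> linarith)
      map_rel_iff' := fun {s t} => by
        simp only [Equiv.coe_fn_mk, ← Subtype.coe_le_coe]
        split_ifs <;> constructor <;> intro h <;> linarith }

/-- The homeomorphism underlying the first standard generator of `F`. -/
noncomputable def x0Homeo : unitInterval ≃ₜ unitInterval := x0OrderIso.toHomeomorph

theorem x0Homeo_apply (t : unitInterval) : (x0Homeo t : ℝ) =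
    if (t : ℝ) ≤ 1 / 4 then 2 * (t : ℝ) else
      if (t : ℝ) ≤ 1 / 2 then (t : ℝ) + 1 / 4 else (t : ℝ) / 2 + 1 / 2 := rfl

/-- The homeomorphism underlying the second standard generator of `F`. -/
noncomputable def x1Homeo : unitInterval ≃ₜ unitInterval := x1OrderIso.toHomeomorph

theorem x1Homeo_apply (t : unitInterval) : (x1Homeo t : ℝ) =
    if (t : ℝ) ≤ 1 / 2 then (t : ℝ) else
      if (t : ℝ) ≤ 5 / 8 then 2 * (t : ℝ) - 1 / 2 else
      if (t : ℝ) ≤ 3 / 4 then (t : ℝ) + 1 / 8 else (t : ℝ) / 2 + 1 / 2 := rfl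

theorem x0Homeo_strictMono : StrictMono x0Homeo := x0OrderIso.strictMono

theorem x1Homeo_strictMono : StrictMono x1Homeo := x1OrderIso.strictMono

/-- The breakpoints of the two standard generators. -/
def standardBreaks : Set unitInterval :=
  {⟨1 / 4, by norm_num, by norm_num⟩, ⟨1 / 2, by norm_num, by norm_num⟩,
    ⟨5 / 8, by norm_num, by norm_num⟩, ⟨3 / 4, by norm_num, by norm_num⟩}

theorem standardBreaks_finite : standardBreaks.Finite := by
  unfold standardBreaks; exact toFinite _

theorem standardBreaks_dyadic : ∀ s ∈ standardBreaks, IsDyadic (s : ℝ) := by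
  rintro s (rfl | rfl | rfl | rfl)
  · exact ⟨1, 2, by norm_num⟩
  · exact ⟨1, 1, by norm_num⟩
  · exact ⟨5, 3, by norm_num⟩
  · exact ⟨3, 2, by norm_num⟩

theorem standardBreaks_avoid {x y : unitInterval}
    (hs : ∀ s ∈ standardBreaks, ¬ (x < s ∧ s < y)) :
    ((1 / 4 : ℝ) ≤ x ∨ (y : ℝ) ≤ 1 / 4) ∧ ((1 / 2 : ℝ) ≤ x ∨ (y : ℝ) ≤ 1 / 2) ∧
    ((5 / 8 : ℝ) ≤ x ∨ (y : ℝ) ≤ 5 / 8) ∧ ((3 / 4 : ℝ) ≤ x ∨ (y : ℝ) ≤ 3 / 4) := by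
  simp only [standardBreaks, mem_insert_iff, mem_singleton_iff, forall_eq_or_imp, forall_eq,
    not_and_or, not_lt, ← Subtype.coe_le_coe] at hs
  exact hs

theorem x0Homeo_affineOff : AffineOff standardBreaks powersOfTwo x0Homeo := by
  intro x y hxy hs
  obtain ⟨h1, h2, -, -⟩ := standardBreaks_avoid hs
  have hxy' : (x : ℝ) < y := hxy
  rcases h1 with h1 | h1
  · rcases h2 with h2 | h2
    · refine ⟨1 / 2, ⟨-1, by norm_num⟩, fun z hz hz' => ?_⟩
      have hz : (x : ℝ) ≤ z := hz
      have hz' : (z : ℝ) ≤ y := hz'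
      simp only [x0Homeo_apply]; split_ifs <;> linarith
    · refine ⟨1, ⟨0, by norm_num⟩, fun z hz hz' => ?_⟩
      have hz : (x : ℝ) ≤ z := hz
      have hz' : (z : ℝ) ≤ y := hz'
      simp only [x0Homeo_apply]; split_ifs <;> linarith
  · refine ⟨2, ⟨1, by norm_num⟩, fun z hz hz' => ?_⟩
    have hz : (x : ℝ) ≤ z := hz
    have hz' : (z : ℝ) ≤ y := hz'
    simp only [x0Homeo_apply]; split_ifs <;> linarith

theorem x1Homeo_affineOff : AffineOff standardBreaks powersOfTwo x1Homeo := by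
  intro x y hxy hs
  obtain ⟨-, h1, h2, h3⟩ := standardBreaks_avoid hs
  have hxy' : (x : ℝ) < y := hxy
  rcases h1 with h1 | h1
  · rcases h2 with h2 | h2
    · rcases h3 with h3 | h3
      · refine ⟨1 / 2, ⟨-1, by norm_num⟩, fun z hz hz' => ?_⟩
        have hz : (x : ℝ) ≤ z := hz
        have hz' : (z : ℝ) ≤ y := hz'
        simp only [x1Homeo_apply]; split_ifs <;> linarith
      · refine ⟨1, ⟨0, by norm_num⟩, fun z hz hz' => ?_⟩
        have hz : (x : ℝ) ≤ z := hz
        have hz' : (z : ℝ) ≤ y := hz'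
        simp only [x1Homeo_apply]; split_ifs <;> linarith
    · refine ⟨2, ⟨1, by norm_num⟩, fun z hz hz' => ?_⟩
      have hz : (x : ℝ) ≤ z := hz
      have hz' : (z : ℝ) ≤ y := hz'
      simp only [x1Homeo_apply]; split_ifs <;> linarith
  · refine ⟨1, ⟨0, by norm_num⟩, fun z hz hz' => ?_⟩
    have hz : (x : ℝ) ≤ z := hz
    have hz' : (z : ℝ) ≤ y := hz'
    simp only [x1Homeo_apply]; split_ifs <;> linarith

theorem AffineOff.mono_slopes {S : Set unitInterval} {M N : Set ℝ} (h : M ⊆ N)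
    {f : unitInterval → unitInterval} (hf : AffineOff S M f) : AffineOff S N f := by
  intro x y hxy hs
  obtain ⟨m, hm, hm'⟩ := hf x y hxy hs
  exact ⟨m, h hm, hm'⟩

/-- The standard generator `x₀` of `F`. -/
noncomputable def x0 : ThompsonF :=
  ⟨⟨x0Homeo, x0Homeo_strictMono, standardBreaks, standardBreaks_finite,
    x0Homeo_affineOff.mono_slopes (subset_univ _)⟩,
    standardBreaks, standardBreaks_finite, standardBreaks_dyadic, x0Homeo_affineOff⟩

/-- The standard generator `x₁` of `F`. -/
noncomputable def x1 : ThompsonF :=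
  ⟨⟨x1Homeo, x1Homeo_strictMono, standardBreaks, standardBreaks_finite,
    x1Homeo_affineOff.mono_slopes (subset_univ _)⟩,
    standardBreaks, standardBreaks_finite, standardBreaks_dyadic, x1Homeo_affineOff⟩

/-- `f₀` and `f₁` generate a standard isomorphic copy of `F`: the subgroup they generate is
isomorphic to `F` by an isomorphism sending `x₀` to `f₀` and `x₁` to `f₁`. Since the same order of
composition is used in both groups, the notion does not depend on whether products of
homeomorphisms are read from left to right or from right to left. -/
def GeneratesStandardCopy (f₀ f₁ : PL0) : Prop :=
  ∃ φ : ThompsonF ≃* Subgroup.closure ({f₀, f₁} : Set PL0),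
    (φ x0 : PL0) = f₀ ∧ (φ x1 : PL0) = f₁

/-- `(a, c)` is an orbital of `f`, that is, one of the disjoint maximal open intervals that make up
the support `{x | f x ≠ x}` (the points `0` and `1` are always fixed). -/
def IsOrbital (f : PL0) (a c : unitInterval) : Prop :=
  a < c ∧ f.1 a = a ∧ f.1 c = c ∧ ∀ x ∈ Ioo a c, f.1 x ≠ x

/-- The orbital `(a, c)` of `f` is an up-bump. -/
def IsUpBump (f : PL0) (a c : unitInterval) : Prop :=
  IsOrbital f a c ∧ ∀ x ∈ Ioo a c, x < f.1 x

/-- The orbital `(a, c)` of `f` is a down-bump. -/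
def IsDownBump (f : PL0) (a c : unitInterval) : Prop :=
  IsOrbital f a c ∧ ∀ x ∈ Ioo a c, f.1 x < x

/-- `(b 0, d 0), …, (b n, d n)` are all the orbitals of `f` that are properly contained in
`(a, c)`, in increasing order (there is at least one of them). -/
structure IsOrbitalList (f : PL0) (a c : unitInterval) {n : ℕ}
    (b d : Fin (n + 1) → unitInterval) : Prop where
  orbital : ∀ i, IsOrbital f (b i) (d i)
  subset : ∀ i, Ioo (b i) (d i) ⊂ Ioo a c
  increasing : StrictMono b
  complete : ∀ u v, IsOrbital f u v → Ioo u v ⊂ Ioo a c → ∃ i, u = b i ∧ v = d i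

/-- The points `q ≤ c` such that `f₀` and `f₁` agree on `[q, c]`. -/
def agreeUpTo (f₀ f₁ : PL0) (c : unitInterval) : Set unitInterval :=
  {q | q ≤ c ∧ EqOn f₀.1 f₁.1 (Icc q c)}

/-- The points `q ≥ a` such that `f₀` and `f₁` agree on `[a, q]`. -/
def agreeFrom (f₀ f₁ : PL0) (a : unitInterval) : Set unitInterval :=
  {q | a ≤ q ∧ EqOn f₀.1 f₁.1 (Icc a q)}

/-- The conditions imposed on an up-bump `(a, c)` of `f₀`, where `(b i, d i)` are the orbitals of
`f₁` properly contained in it. -/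
structure NiceUp (f₀ f₁ : PL0) (a c : unitInterval) {n : ℕ}
    (b d : Fin (n + 1) → unitInterval) : Prop where
  cond_i : a < b 0
  cond_ii : ∃ p < c, p ∈ agreeUpTo f₀ f₁ c
  cond_iii : d (Fin.last n) = c
  cond_iv : ∀ p, IsLeast (agreeUpTo f₀ f₁ c) p → p ≤ f₀.1 (b (Fin.last n))
  cond_v : b (Fin.last n) < f₀.1 (b 0)
  cond_extra : ∀ p, IsLeast (agreeUpTo f₀ f₁ c) p → p ≤ f₀.1 (b 0)

/-- The conditions imposed on a down-bump `(a, c)` of `f₀`, where `(b i, d i)` are the orbitals of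
`f₁` properly contained in it. -/
structure NiceDown (f₀ f₁ : PL0) (a c : unitInterval) {n : ℕ}
    (b d : Fin (n + 1) → unitInterval) : Prop where
  cond_i : d (Fin.last n) < c
  cond_ii : ∃ ρ > a, ρ ∈ agreeFrom f₀ f₁ a
  cond_iii : b 0 = a
  cond_iv : ∀ ρ, IsGreatest (agreeFrom f₀ f₁ a) ρ → f₀.1 (d 0) ≤ ρ
  cond_v : f₀.1 (d (Fin.last n)) < d 0
  cond_extra : ∀ ρ, IsGreatest (agreeFrom f₀ f₁ a) ρ → f₀.1 (d (Fin.last n)) ≤ ρ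

/-! The argument combines a rigidity statement in group theory with a disjoint-support argument.

Rigidity: if a⁻¹b commutes with a^n b a^(-n) for n = 1, 2, then `thompsonSeq a b` satisfies the
infinite presentation of Thompson's group, and every element of ⟨a, b⟩ is a quotient of two sorted
positive words. Sorted words are normal forms as soon as a and b do not commute
(`IsThompsonSeq.prod_injOn`). So a homomorphism out of ⟨a, b⟩ whose images of a and b do not commute
is injective; this is the fact that proper quotients of F are abelian. Applied to both projections
of the subgroup of G × K generated by (a, c) and (b, d), it gives the isomorphism
(`ThompsonRel.exists_mulEquiv`). It remains to check the relations for both pairs and that x₀, x₁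
generate F.

Relations: products of homeomorphisms compose from right to left here. On an up-bump (a, c) with
first inner orbital starting at b, `f₁` is trivial on [a, b], so f₀^n f₁ f₀^(-n) is trivial on [a,
f₀^n b]; and f₀⁻¹f₁ is trivial on [f₀ b, c], where the maps agree. For n ≥ 1 the two supports are
separated. Down-bumps are the mirror image, and off the orbitals of `f₀` nesting makes the relations
trivial.

Generation (`closure_x0_x1`): an element of F maps a finite dyadic subdivision affinely onto
standard dyadic intervals. Products of the xₙ turn the comb 0, 10, 110, … into that subdivision, and
further products push the images back onto the comb. -/

section ThompsonSeq

/-! ### From two relations to the infinite presentation. -/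

variable {G : Type*} [Group G]

/-- The two defining relations of Thompson's group for the pair `a`, `b`. -/
def ThompsonRel (a b : G) : Prop :=
  ∀ n : ℕ, n = 1 ∨ n = 2 → Commute (a⁻¹ * b) (a ^ n * b * (a ^ n)⁻¹)

/-- The generators of the infinite presentation of Thompson's group built from `a`, `b`. -/
def thompsonSeq (a b : G) : ℕ → G
  | 0 => a⁻¹
  | n + 1 => a ^ n * b⁻¹ * (a ^ n)⁻¹

theorem map_thompsonSeq {K : Type*} [Group K] (φ : G →* K) (a b : G) (n : ℕ) :
    φ (thompsonSeq a b n) = thompsonSeq (φ a) (φ b) n := by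
  cases n <;> simp [thompsonSeq]

theorem thompsonSeq_conj (a b : G) (n : ℕ) :
    a * thompsonSeq a b (n + 1) * a⁻¹ = thompsonSeq a b (n + 2) := by
  simp only [thompsonSeq, pow_succ' a n]
  group

theorem thompsonSeq_conj_pow (a b : G) (n k : ℕ) :
    a ^ k * thompsonSeq a b (n + 1) * (a ^ k)⁻¹ = thompsonSeq a b (n + k + 1) := by
  simp only [thompsonSeq, add_comm n k, pow_add a]
  group

/-- The two given relations start an induction: each later term is the conjugate of its predecessor
by y₂, and both of these already commute with a⁻¹b. -/
theorem ThompsonRel.commute_seq {a b : G} (h : ThompsonRel a b) (n : ℕ) :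
    Commute (a⁻¹ * b) (thompsonSeq a b (n + 2)) := by
  have base : ∀ n, n = 1 ∨ n = 2 → Commute (a⁻¹ * b) (thompsonSeq a b (n + 1)) := by
    intro n hn
    have := (h n hn).inv_right
    simpa [thompsonSeq, mul_assoc] using this
  induction n using Nat.strong_induction_on with
  | _ n ih =>
    match n, ih with
    | 0, _ => exact base 1 (Or.inl rfl)
    | 1, _ => exact base 2 (Or.inr rfl)
    | n + 2, ih =>
      have h0 := ih 0 (by omega)
      have h1 := ih (n + 1) (by omega)
      have h2 := ih n (by omega)
      have e : thompsonSeq a b (n + 2 + 2) =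
          (thompsonSeq a b 2)⁻¹ * thompsonSeq a b (n + 3) * thompsonSeq a b 2 := by
        -- Since a⁻¹b commutes with this term, conjugation by b agrees with conjugation by a, which
        -- shifts the index.
        have e3 : b * thompsonSeq a b (n + 2) * b⁻¹ = thompsonSeq a b (n + 3) := by
          rw [← thompsonSeq_conj a b (n + 1)]
          have h3 := h2.eq
          calc b * thompsonSeq a b (n + 2) * b⁻¹
              = a * (a⁻¹ * b * thompsonSeq a b (n + 2)) * b⁻¹ := by group
            _ = _ := by rw [h3]; group
        calc thompsonSeq a b (n + 2 + 2) = a * (b * thompsonSeq a b (n + 2) * b⁻¹) * a⁻¹ := by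
              rw [e3]; exact (thompsonSeq_conj a b (n + 2)).symm
          _ = (thompsonSeq a b 2)⁻¹ * (a * thompsonSeq a b (n + 2) * a⁻¹) * thompsonSeq a b 2 := by
              simp only [thompsonSeq]
              group
          _ = _ := by rw [thompsonSeq_conj a b (n + 1)]
      rw [e]
      exact (h0.inv_right.mul_right h1).mul_right h0

/-- The relations of the infinite presentation of Thompson's group. -/
def IsThompsonSeq (y : ℕ → G) : Prop := ∀ i j, i < j → y j * y i = y i * y (j + 1)

/-- For i = 0 the relation is conjugation by a; otherwise conjugating by a power of a reduces it to
i = 1, where y₁ = b⁻¹. -/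
theorem ThompsonRel.isThompsonSeq {a b : G} (h : ThompsonRel a b) :
    IsThompsonSeq (thompsonSeq a b) := by
  intro i j hij
  obtain ⟨k, rfl⟩ : ∃ k, j = i + k + 1 := ⟨j - i - 1, by omega⟩
  cases i with
  | zero =>
    rw [← thompsonSeq_conj]
    simp [thompsonSeq, mul_assoc]
  | succ i =>
    have h2 := (h.commute_seq k).eq
    have e3 : b * thompsonSeq a b (k + 2) * b⁻¹ = thompsonSeq a b (k + 3) := by
      rw [← thompsonSeq_conj a b (k + 1)]
      calc b * thompsonSeq a b (k + 2) * b⁻¹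
          = a * (a⁻¹ * b * thompsonSeq a b (k + 2)) * b⁻¹ := by group
        _ = _ := by rw [h2]; group
    have e4 := thompsonSeq_conj_pow a b (k + 1) i
    have e5 := thompsonSeq_conj_pow a b (k + 2) i
    rw [show i + 1 + k + 1 = k + 1 + i + 1 by ring, ← e4,
      show k + 1 + i + 1 + 1 = k + 2 + i + 1 by ring, ← e5, ← e3]
    simp only [thompsonSeq]
    group

/-! ### Fractions of sorted words and their uniqueness. -/

/-- Sorted insertion of `j` in front of a word, modulo the relations `y j * y i = y i * y (j + 1)`
for `i < j`. -/
def thompsonInsert (j : ℕ) : List ℕ → List ℕ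
  | [] => [j]
  | i :: L => if j ≤ i then j :: i :: L else i :: thompsonInsert (j + 1) L

theorem le_of_mem_thompsonInsert {m : ℕ} (L : List ℕ) {j : ℕ} (hj : m ≤ j) (hL : ∀ k ∈ L, m ≤ k) :
    ∀ k ∈ thompsonInsert j L, m ≤ k := by
  induction L generalizing j with
  | nil => simpa [thompsonInsert] using hj
  | cons i L ih =>
    simp only [thompsonInsert]
    simp only [List.mem_cons, forall_eq_or_imp] at hL
    split_ifs
    · simpa using ⟨hj, hL.1, hL.2⟩
    · simpa using ⟨hL.1, ih (by omega) hL.2⟩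

theorem pairwise_thompsonInsert (L : List ℕ) (hL : L.Pairwise (· ≤ ·)) (j : ℕ) :
    (thompsonInsert j L).Pairwise (· ≤ ·) := by
  induction L generalizing j with
  | nil => simp [thompsonInsert]
  | cons i L ih =>
    simp only [thompsonInsert]
    rw [List.pairwise_cons] at hL
    split_ifs with h
    · simp only [List.pairwise_cons, List.mem_cons, forall_eq_or_imp]
      exact ⟨⟨h, fun k hk => h.trans (hL.1 k hk)⟩, hL⟩
    · rw [List.pairwise_cons]
      exact ⟨le_of_mem_thompsonInsert L (by omega) hL.1, ih hL.2 _⟩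

/-- A sorted word equal to the given one modulo the relations of Thompson's group. -/
def thompsonSort : List ℕ → List ℕ
  | [] => []
  | j :: L => thompsonInsert j (thompsonSort L)

theorem pairwise_thompsonSort (L : List ℕ) : (thompsonSort L).Pairwise (· ≤ ·) := by
  induction L with
  | nil => simp [thompsonSort]
  | cons j L ih => exact pairwise_thompsonInsert _ ih j

namespace IsThompsonSeq

variable {y : ℕ → G}

theorem prod_insert (hy : IsThompsonSeq y) (L : List ℕ) (j : ℕ) :
    ((thompsonInsert j L).map y).prod = y j * (L.map y).prod := by
  induction L generalizing j with
  | nil => simp [thompsonInsert]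
  | cons i L ih =>
    simp only [thompsonInsert]
    split_ifs with h
    · simp
    · simp only [List.map_cons, List.prod_cons, ih]
      rw [← mul_assoc, ← mul_assoc, hy i j (by omega)]

theorem prod_sort (hy : IsThompsonSeq y) (L : List ℕ) :
    ((thompsonSort L).map y).prod = (L.map y).prod := by
  induction L with
  | nil => simp [thompsonSort]
  | cons j L ih => simp [thompsonSort, hy.prod_insert, ih]

/-- An inverse letter moves right past a positive one at the cost of raising the larger of the two
indices, until it cancels or reaches the end. -/
theorem inv_mul_prod (hy : IsThompsonSeq y) (L : List ℕ) (i : ℕ) :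
    ∃ P N : List ℕ, (y i)⁻¹ * (L.map y).prod = (P.map y).prod * ((N.map y).prod)⁻¹ := by
  induction L generalizing i with
  | nil => exact ⟨[], [i], by simp⟩
  | cons j L ih =>
    rcases lt_trichotomy i j with h | rfl | h
    · obtain ⟨P, N, e⟩ := ih i
      refine ⟨(j + 1) :: P, N, ?_⟩
      simp only [List.map_cons, List.prod_cons]
      rw [mul_assoc, ← e, ← mul_assoc, ← mul_assoc]
      congr 1
      rw [inv_mul_eq_iff_eq_mul, ← mul_assoc, ← hy i j h, mul_inv_cancel_right]
    · exact ⟨L, [], by simp⟩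
    · obtain ⟨P, N, e⟩ := ih (i + 1)
      refine ⟨j :: P, N, ?_⟩
      simp only [List.map_cons, List.prod_cons]
      rw [mul_assoc, ← e, ← mul_assoc, ← mul_assoc]
      congr 1
      rw [inv_mul_eq_iff_eq_mul, ← mul_assoc, hy j i h, mul_inv_cancel_right]

theorem exists_fraction (hy : IsThompsonSeq y) {g : G}
    (hg : g ∈ Subgroup.closure (range y)) :
    ∃ P N : List ℕ, P.Pairwise (· ≤ ·) ∧ N.Pairwise (· ≤ ·) ∧
      g = (P.map y).prod * ((N.map y).prod)⁻¹ := by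
  suffices H : ∃ P N : List ℕ, g = (P.map y).prod * ((N.map y).prod)⁻¹ by
    obtain ⟨P, N, rfl⟩ := H
    exact ⟨thompsonSort P, thompsonSort N, pairwise_thompsonSort P, pairwise_thompsonSort N, by
      rw [hy.prod_sort, hy.prod_sort]⟩
  induction hg using Subgroup.closure_induction_left with
  | one => exact ⟨[], [], by simp⟩
  | mul_left x hx g _ ih =>
    obtain ⟨i, rfl⟩ := hx
    obtain ⟨P, N, rfl⟩ := ih
    exact ⟨i :: P, N, by simp [mul_assoc]⟩
  | inv_mul_cancel x hx g _ ih =>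
    obtain ⟨i, rfl⟩ := hx
    obtain ⟨P, N, rfl⟩ := ih
    obtain ⟨P', N', e⟩ := hy.inv_mul_prod P i
    refine ⟨P', N ++ N', ?_⟩
    rw [← mul_assoc, e]
    simp [mul_assoc]

theorem pow_conj (hy : IsThompsonSeq y) {i j : ℕ} (h : i < j) (a : ℕ) :
    y j * y i ^ a = y i ^ a * y (j + a) := by
  induction a with
  | zero => simp
  | succ a ih =>
    rw [pow_succ, ← mul_assoc, ih, mul_assoc, hy i (j + a) (by omega), ← mul_assoc, add_assoc]

/-- If a power of `y m` lies in the subgroup generated by the later generators, then `y 0` and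
`y 1` commute. -/
theorem commute_of_pow_mem (hy : IsThompsonSeq y) {m a : ℕ} (ha : 0 < a)
    (hu : y m ^ a ∈ Subgroup.closure (y '' Ioi m)) : Commute (y 0) (y 1) := by
  -- Conjugation by y m raises later indices by one but fixes y m ^ a, so this power even lies in
  -- the subgroup generated from index m + 2 on.
  have shift : ∀ u ∈ Subgroup.closure (y '' Ioi m),
      (y m)⁻¹ * u * y m ∈ Subgroup.closure (y '' Ioi (m + 1)) := by
    intro u hu
    induction hu using Subgroup.closure_induction with
    | mem x hx =>
      obtain ⟨k, hk, rfl⟩ := hx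
      rw [mul_assoc, hy m k hk, inv_mul_cancel_left]
      exact Subgroup.subset_closure ⟨k + 1, by simpa using hk, rfl⟩
    | one => simp
    | mul x z _ _ hx hz =>
      have := mul_mem hx hz
      convert this using 1
      group
    | inv x _ hx =>
      have := inv_mem hx
      convert this using 1
      group
  have hmem := shift _ hu
  have hself : (y m)⁻¹ * y m ^ a * y m = y m ^ a := by
    rw [mul_assoc, ← pow_succ, pow_succ', inv_mul_cancel_left]
  rw [hself] at hmem
  -- On letters of index above m + 1, conjugation by y m and by y (m + 1) has the same effect, so
  -- their quotient centralizes them.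
  have hcent : Subgroup.closure (y '' Ioi (m + 1)) ≤
      Subgroup.centralizer {y (m + 1) * (y m)⁻¹} := by
    rw [Subgroup.closure_le]
    rintro _ ⟨k, hk, rfl⟩
    have hk' : m + 1 < k := hk
    rw [SetLike.mem_coe, Subgroup.mem_centralizer_singleton_iff]
    obtain ⟨l, rfl⟩ : ∃ l, k = l + 1 := ⟨k - 1, by omega⟩
    have e1 := hy m l (by omega)
    have e2 := hy (m + 1) (l + 1) hk'
    have e3 := hy m (l + 1) (by omega)
    have e4 : (y m)⁻¹ * y (l + 1) = y (l + 1 + 1) * (y m)⁻¹ := by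
      rw [inv_mul_eq_iff_eq_mul, ← mul_assoc, ← e3, mul_inv_cancel_right]
    rw [← mul_assoc, e2, mul_assoc, mul_assoc, e4]
  have hc := Subgroup.mem_centralizer_singleton_iff.1 (hcent hmem)
  have hc2 : y (m + 1) * y m ^ a = y m ^ a * y (m + 1) := by
    have h1 : y (m + 1) * (y m)⁻¹ * y m ^ a = y (m + 1) * y m ^ a * (y m)⁻¹ := by
      rw [mul_assoc, mul_assoc, ((Commute.refl (y m)).inv_left.pow_right a).eq]
    rw [h1, ← mul_assoc] at hc
    exact (mul_right_cancel hc).symm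
  -- Commuting with y m ^ a while being shifted by a past it forces a coincidence of letters. As a >
  -- 0, one more relation makes two consecutive letters equal, and undoing conjugation by y 0 ^ (m +
  -- a) gives y 1 = y 2.
  have e1 : y (m + 1) = y (m + 1 + a) := by
    rw [hy.pow_conj (Nat.lt_succ_self m)] at hc2
    exact (mul_left_cancel hc2).symm
  have e2 : y (m + 1) = y (m + 1 + a + 1) := by
    have := hy (m + 1) (m + 1 + a) (by omega)
    rw [← e1] at this
    exact mul_left_cancel this
  have e3 : y (1 + (m + a)) = y (2 + (m + a)) := by
    rw [show 1 + (m + a) = m + 1 + a by ring, show 2 + (m + a) = m + 1 + a + 1 by ring, ← e1, ← e2]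
  have h1 := hy.pow_conj (i := 0) (j := 1) (by omega) (m + a)
  have h2 := hy.pow_conj (i := 0) (j := 2) (by omega) (m + a)
  rw [e3, ← h2] at h1
  have h12 := mul_right_cancel h1
  have h3 := hy 0 1 (by omega)
  rw [← h12] at h3
  exact h3.symm

theorem exists_pow_mul (L : List ℕ) (hL : L.Pairwise (· ≤ ·)) {m : ℕ} (hm : ∀ k ∈ L, m ≤ k) :
    ∃ a : ℕ, ∃ w ∈ Subgroup.closure (y '' Ioi m), (L.map y).prod = y m ^ a * w := by
  induction L with
  | nil => exact ⟨0, 1, one_mem _, by simp⟩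
  | cons k L ih =>
    rw [List.pairwise_cons] at hL
    simp only [List.mem_cons, forall_eq_or_imp] at hm
    rcases hm.1.eq_or_lt with rfl | h
    · obtain ⟨a, w, hw, e⟩ := ih hL.2 hm.2
      exact ⟨a + 1, w, hw, by simp [e, pow_succ', mul_assoc]⟩
    · refine ⟨0, ((k :: L).map y).prod, Subgroup.list_prod_mem _ ?_, by simp⟩
      simp only [List.mem_map, List.mem_cons]
      rintro _ ⟨l, rfl | hl, rfl⟩
      · exact Subgroup.subset_closure ⟨l, h, rfl⟩
      · exact Subgroup.subset_closure ⟨l, h.trans_le (hL.1 l hl), rfl⟩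

/-- Equality would express a positive power of y m by later letters, which `commute_of_pow_mem`
forbids. -/
theorem prod_ne (hy : IsThompsonSeq y) (hc : ¬ Commute (y 0) (y 1)) {m : ℕ} {L L' : List ℕ}
    (hL : (m :: L).Pairwise (· ≤ ·)) (hm : ∀ k ∈ L', m < k) :
    ((m :: L).map y).prod ≠ (L'.map y).prod := by
  intro e
  rw [List.pairwise_cons] at hL
  obtain ⟨a, w, hw, e'⟩ := exists_pow_mul (y := y) L hL.2 hL.1
  refine hc (hy.commute_of_pow_mem (m := m) (a := a + 1) (Nat.succ_pos a) ?_)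
  have : y m ^ (a + 1) = (L'.map y).prod * w⁻¹ := by
    rw [← e, eq_mul_inv_iff_mul_eq]
    simp [e', pow_succ', mul_assoc]
  rw [this]
  refine mul_mem (Subgroup.list_prod_mem _ ?_) (inv_mem hw)
  simp only [List.mem_map]
  rintro _ ⟨l, hl, rfl⟩
  exact Subgroup.subset_closure ⟨l, hm l hl, rfl⟩

/-- Sorted words are normal forms, as soon as `y 0` and `y 1` do not commute. -/
theorem prod_injOn (hy : IsThompsonSeq y) (hc : ¬ Commute (y 0) (y 1)) :
    InjOn (fun L : List ℕ => (L.map y).prod) {L | L.Pairwise (· ≤ ·)} := by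
  intro L hL L' hL' e
  change L.Pairwise (· ≤ ·) at hL
  change L'.Pairwise (· ≤ ·) at hL'
  change (L.map y).prod = (L'.map y).prod at e
  revert hL hL' e
  induction L generalizing L' with
  | nil =>
    cases L' with
    | nil => intros; rfl
    | cons m L' => intro _ hL' e; exact absurd e.symm (hy.prod_ne hc hL' (by simp))
  | cons m L ih =>
    cases L' with
    | nil => intro hL _ e; exact absurd e (hy.prod_ne hc hL (by simp))
    | cons n L' =>
      intro hL hL' e
      rcases lt_trichotomy m n with h | rfl | h
      · refine absurd e (hy.prod_ne hc hL ?_)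
        simpa using ⟨h, fun k hk => h.trans_le ((List.pairwise_cons.1 hL').1 k hk)⟩
      · rw [ih hL.of_cons hL'.of_cons (by simpa using e)]
      · refine absurd e.symm (hy.prod_ne hc hL' ?_)
        simpa using ⟨h, fun k hk => h.trans_le ((List.pairwise_cons.1 hL).1 k hk)⟩

end IsThompsonSeq

/-! ### Rigidity of noncommuting Thompson pairs. -/

theorem closure_range_thompsonSeq (a b : G) :
    Subgroup.closure (range (thompsonSeq a b)) = Subgroup.closure {a, b} := by
  apply le_antisymm
  · rw [Subgroup.closure_le]
    have ha : a ∈ Subgroup.closure ({a, b} : Set G) := Subgroup.subset_closure (by simp)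
    have hb : b ∈ Subgroup.closure ({a, b} : Set G) := Subgroup.subset_closure (by simp)
    rintro _ ⟨n, rfl⟩
    cases n with
    | zero => exact inv_mem ha
    | succ n => exact mul_mem (mul_mem (pow_mem ha n) (inv_mem hb)) (inv_mem (pow_mem ha n))
  · rw [Subgroup.closure_le]
    have h0 := Subgroup.subset_closure (mem_range_self (f := thompsonSeq a b) 0)
    have h1 := Subgroup.subset_closure (mem_range_self (f := thompsonSeq a b) 1)
    rintro x (rfl | rfl)
    · simpa [thompsonSeq] using h0
    · simpa [thompsonSeq] using h1

/-- A homomorphism to a group in which the images of `a` and `b` do not commute is injective on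
a subgroup generated by `a` and `b` that satisfy Thompson's relations. -/
theorem ThompsonRel.eq_one_of_map_eq_one {K : Type*} [Group K] {a b : G} (h : ThompsonRel a b)
    (φ : G →* K) (hc : ¬ Commute (φ a) (φ b)) {g : G} (hg : g ∈ Subgroup.closure {a, b})
    (hφ : φ g = 1) : g = 1 := by
  rw [← closure_range_thompsonSeq] at hg
  obtain ⟨P, N, hP, hN, rfl⟩ := h.isThompsonSeq.exists_fraction hg
  have hφrel : ThompsonRel (φ a) (φ b) := by
    intro n hn
    simpa using (h n hn).map φ
  have hmap : ∀ L : List ℕ, φ ((L.map (thompsonSeq a b)).prod) =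
      (L.map (thompsonSeq (φ a) (φ b))).prod := by
    intro L
    rw [map_list_prod, List.map_map]
    congr 2
    funext n
    exact map_thompsonSeq φ a b n
  have hc' : ¬ Commute (thompsonSeq (φ a) (φ b) 0) (thompsonSeq (φ a) (φ b) 1) := by
    intro h
    exact hc (by simpa [thompsonSeq] using h.inv_inv)
  rw [map_mul, map_inv, hmap, hmap, mul_inv_eq_one] at hφ
  rw [hφrel.isThompsonSeq.prod_injOn hc' hP hN hφ, mul_inv_cancel]

/-- Noncommuting pairs that satisfy Thompson's relations generate isomorphic groups. -/
theorem ThompsonRel.exists_mulEquiv {K : Type*} [Group K] {a b : G} {c d : K}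
    (h : ThompsonRel a b) (h' : ThompsonRel c d) (hab : ¬ Commute a b) (hcd : ¬ Commute c d)
    (htop : Subgroup.closure {a, b} = ⊤) :
    ∃ φ : G ≃* Subgroup.closure {c, d}, (φ a : K) = c ∧ (φ b : K) = d := by
  have hrel : ThompsonRel (a, c) (b, d) := fun n hn => Prod.ext (h n hn) (h' n hn)
  -- D is the graph of the desired isomorphism: it remains to see that both projections are
  -- bijective onto their targets.
  let D : Subgroup (G × K) := Subgroup.closure {(a, c), (b, d)}
  let p : D →* G := (MonoidHom.fst G K).comp D.subtype
  let q : D →* K := (MonoidHom.snd G K).comp D.subtype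
  have hp : Function.Injective p := by
    rw [injective_iff_map_eq_one]
    rintro ⟨x, hx⟩ e
    exact Subtype.ext (hrel.eq_one_of_map_eq_one (MonoidHom.fst G K) hab hx e)
  have hq : Function.Injective q := by
    rw [injective_iff_map_eq_one]
    rintro ⟨x, hx⟩ e
    exact Subtype.ext (hrel.eq_one_of_map_eq_one (MonoidHom.snd G K) hcd hx e)
  have hps : p.range = ⊤ := by
    rw [MonoidHom.range_comp, Subgroup.range_subtype, MonoidHom.map_closure, ← htop]
    congr 1
    simp [image_pair]
  have hqs : q.range = Subgroup.closure {c, d} := by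
    rw [MonoidHom.range_comp, Subgroup.range_subtype, MonoidHom.map_closure]
    congr 1
    simp [image_pair]
  let e₁ : D ≃* G := MulEquiv.ofBijective p ⟨hp, MonoidHom.range_eq_top.1 hps⟩
  let e₂ : D ≃* Subgroup.closure {c, d} :=
    (MonoidHom.ofInjective hq).trans (MulEquiv.subgroupCongr hqs)
  have ha : e₁.symm a = ⟨(a, c), Subgroup.subset_closure (by simp)⟩ := by
    rw [MulEquiv.symm_apply_eq]; rfl
  have hb : e₁.symm b = ⟨(b, d), Subgroup.subset_closure (by simp)⟩ := by
    rw [MulEquiv.symm_apply_eq]; rfl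
  refine ⟨e₁.symm.trans e₂, ?_, ?_⟩
  · rw [MulEquiv.trans_apply, ha]; rfl
  · rw [MulEquiv.trans_apply, hb]; rfl

end ThompsonSeq

/-! ### Thompson's relations from separated supports. -/

/-- Two maps that preserve `[a, c]` commute on it if one is the identity below `q` and the other
one above `q`. -/
theorem comm_apply_of_split {g k : unitInterval → unitInterval} (hg : StrictMono g)
    (hk : StrictMono k) {a c q : unitInterval} (hga : g a = a)
    (hkc : k c = c) (hgq : ∀ x ∈ Icc q c, g x = x) (hkq : ∀ x ∈ Icc a q, k x = x)
    (hq : q ∈ Icc a c) {x : unitInterval} (hx : x ∈ Icc a c) : g (k x) = k (g x) := by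
  have hg' : g q = q := hgq q ⟨le_rfl, hq.2⟩
  have hk' : k q = q := hkq q ⟨hq.1, le_rfl⟩
  rcases le_total x q with h | h
  · rw [hkq x ⟨hx.1, h⟩]
    refine (hkq _ ⟨?_, ?_⟩).symm
    · rw [← hga]; exact hg.monotone hx.1
    · rw [← hg']; exact hg.monotone h
  · rw [hgq x ⟨h, hx.2⟩]
    refine hgq _ ⟨?_, ?_⟩
    · rw [← hk']; exact hk.monotone h
    · rw [← hkc]; exact hk.monotone hx.2

theorem PL0.strictMono (f : PL0) : StrictMono f.1 := f.2.1

theorem PL0.mul_val_apply (f g : PL0) (x : unitInterval) : (f * g).1 x = f.1 (g.1 x) := rfl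

theorem PL0.inv_val_apply_eq_iff (f : PL0) (x y : unitInterval) : f⁻¹.1 x = y ↔ x = f.1 y :=
  f.1.symm_apply_eq

theorem PL0.pow_apply_of_fixed (f : PL0) {x : unitInterval} (h : f.1 x = x) (n : ℕ) :
    (f ^ n).1 x = x := by
  induction n with
  | zero => rfl
  | succ n ih => rw [pow_succ, PL0.mul_val_apply, h, ih]

theorem PL0.conj_apply_eq_self (f g : PL0) {x : unitInterval}
    (h : g.1 (f⁻¹.1 x) = f⁻¹.1 x) : (f * g * f⁻¹).1 x = x := by
  rw [PL0.mul_val_apply, PL0.mul_val_apply, h]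
  exact f.1.apply_symm_apply x

theorem PL0.inv_mul_apply_eq_self (f g : PL0) {x : unitInterval} (h : f.1 x = g.1 x) :
    (f⁻¹ * g).1 x = x := by
  rw [PL0.mul_val_apply, ← h]
  exact f.1.symm_apply_apply x

theorem PL0.inv_apply_mem_Icc (f : PL0) {x u v : unitInterval} (h : x ∈ Icc (f.1 u) (f.1 v)) :
    f⁻¹.1 x ∈ Icc u v := by
  constructor
  · rw [← (PL0.strictMono f).le_iff_le]
    exact h.1.trans (f.1.apply_symm_apply x).ge
  · rw [← (PL0.strictMono f).le_iff_le]
    exact (f.1.apply_symm_apply x).le.trans h.2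

theorem PL0.le_pow_apply (f : PL0) {x : unitInterval} (h : x ≤ f.1 x) (n : ℕ) :
    f.1 x ≤ (f ^ (n + 1)).1 x := by
  induction n with
  | zero => simp
  | succ n ih =>
    refine ih.trans ?_
    rw [pow_succ f (n + 1), PL0.mul_val_apply]
    exact (PL0.strictMono (f ^ (n + 1))).monotone h

theorem PL0.pow_apply_le (f : PL0) {x : unitInterval} (h : f.1 x ≤ x) (n : ℕ) :
    (f ^ (n + 1)).1 x ≤ f.1 x := by
  induction n with
  | zero => simp
  | succ n ih =>
    refine le_trans ?_ ih
    rw [pow_succ f (n + 1), PL0.mul_val_apply]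
    exact (PL0.strictMono (f ^ (n + 1))).monotone h

/-- The pointwise form of Thompson's relations. -/
def PL0.RelAt (f₀ f₁ : PL0) (x : unitInterval) : Prop :=
  ∀ n : ℕ, (f₀⁻¹ * f₁).1 ((f₀ ^ (n + 1) * f₁ * (f₀ ^ (n + 1))⁻¹).1 x) =
    (f₀ ^ (n + 1) * f₁ * (f₀ ^ (n + 1))⁻¹).1 ((f₀⁻¹ * f₁).1 x)

theorem PL0.thompsonRel_of_relAt {f₀ f₁ : PL0} (h : ∀ x, PL0.RelAt f₀ f₁ x) :
    ThompsonRel f₀ f₁ := by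
  rintro _ (rfl | rfl)
  · exact Subtype.ext (Homeomorph.ext fun x => h x 0)
  · exact Subtype.ext (Homeomorph.ext fun x => h x 1)

/-- All powers of `f₀` act trivially on the points met, so both sides reduce to f₁ (f₁ x). -/
theorem PL0.relAt_of_fixed {f₀ f₁ : PL0} {x : unitInterval} (h0 : f₀.1 x = x)
    (h1 : f₀.1 (f₁.1 x) = f₁.1 x) (h2 : f₀.1 (f₁.1 (f₁.1 x)) = f₁.1 (f₁.1 x)) :
    PL0.RelAt f₀ f₁ x := by
  intro n
  have hi : ∀ (g : PL0) (y : unitInterval), g.1 y = y → g⁻¹.1 y = y := fun g y hy => by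
    rw [PL0.inv_val_apply_eq_iff, hy]
  simp only [PL0.mul_val_apply]
  rw [hi _ _ (PL0.pow_apply_of_fixed f₀ h0 _), PL0.pow_apply_of_fixed f₀ h1, hi _ _ h2, hi _ _ h1,
    hi _ _ (PL0.pow_apply_of_fixed f₀ h1 _), PL0.pow_apply_of_fixed f₀ h2]

/-- Thompson's relations hold on an interval on which `f₀` moves points up. -/
theorem PL0.relAt_of_up {f₀ f₁ : PL0} {a c b : unitInterval} (h0a : f₀.1 a = a) (h0c : f₀.1 c = c)
    (h1a : f₁.1 a = a) (h1c : f₁.1 c = c) (hb : b ∈ Icc a c) (hb' : b ≤ f₀.1 b)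
    (hfix : ∀ x ∈ Icc a b, f₁.1 x = x) (hagree : ∀ x ∈ Icc (f₀.1 b) c, f₀.1 x = f₁.1 x)
    {x : unitInterval} (hx : x ∈ Icc a c) : PL0.RelAt f₀ f₁ x := by
  intro n
  have hpa := PL0.pow_apply_of_fixed f₀ h0a (n + 1)
  have hpc := PL0.pow_apply_of_fixed f₀ h0c (n + 1)
  have hia : ((f₀ ^ (n + 1))⁻¹).1 a = a := by rw [PL0.inv_val_apply_eq_iff, hpa]
  have hic : ((f₀ ^ (n + 1))⁻¹).1 c = c := by rw [PL0.inv_val_apply_eq_iff, hpc]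
  -- f₀^(n+1) b separates the supports: it is the image of the point up to which `f₁` is trivial,
  -- and it is at least f₀ b, beyond which the maps agree.
  refine comm_apply_of_split (a := a) (c := c) (q := (f₀ ^ (n + 1)).1 b)
    (PL0.strictMono _) (PL0.strictMono _)
    (PL0.inv_mul_apply_eq_self _ _ (h0a.trans h1a.symm))
    (PL0.conj_apply_eq_self _ _ (by rw [hic, h1c])) ?_ ?_ ?_ hx
  · intro x hx
    exact PL0.inv_mul_apply_eq_self _ _ (hagree x ⟨(PL0.le_pow_apply f₀ hb' n).trans hx.1, hx.2⟩)
  · intro x hx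
    refine PL0.conj_apply_eq_self _ _ (hfix _ (PL0.inv_apply_mem_Icc _ ?_))
    rwa [hpa]
  · constructor
    · rw [← hpa]; exact (PL0.strictMono _).monotone hb.1
    · conv_rhs => rw [← hpc]
      exact (PL0.strictMono _).monotone hb.2

/-- Thompson's relations hold on an interval on which `f₀` moves points down. -/
theorem PL0.relAt_of_down {f₀ f₁ : PL0} {a c d : unitInterval} (h0a : f₀.1 a = a)
    (h0c : f₀.1 c = c) (h1a : f₁.1 a = a) (h1c : f₁.1 c = c) (hd : d ∈ Icc a c)
    (hd' : f₀.1 d ≤ d) (hfix : ∀ x ∈ Icc d c, f₁.1 x = x)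
    (hagree : ∀ x ∈ Icc a (f₀.1 d), f₀.1 x = f₁.1 x)
    {x : unitInterval} (hx : x ∈ Icc a c) : PL0.RelAt f₀ f₁ x := by
  intro n
  have hpa := PL0.pow_apply_of_fixed f₀ h0a (n + 1)
  have hpc := PL0.pow_apply_of_fixed f₀ h0c (n + 1)
  have hia : ((f₀ ^ (n + 1))⁻¹).1 a = a := by rw [PL0.inv_val_apply_eq_iff, hpa]
  have hic : ((f₀ ^ (n + 1))⁻¹).1 c = c := by rw [PL0.inv_val_apply_eq_iff, hpc]
  -- The roles are exchanged: here the conjugate of `f₁` is trivial above the separating point and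
  -- f₀⁻¹f₁ below it.
  symm
  refine comm_apply_of_split (a := a) (c := c) (q := (f₀ ^ (n + 1)).1 d)
    (PL0.strictMono _) (PL0.strictMono _)
    (PL0.conj_apply_eq_self _ _ (by rw [hia, h1a]))
    (PL0.inv_mul_apply_eq_self _ _ (h0c.trans h1c.symm)) ?_ ?_ ?_ hx
  · intro x hx
    refine PL0.conj_apply_eq_self _ _ (hfix _ (PL0.inv_apply_mem_Icc _ ?_))
    rwa [hpc]
  · intro x hx
    exact PL0.inv_mul_apply_eq_self _ _ (hagree x ⟨hx.1, hx.2.trans (PL0.pow_apply_le f₀ hd' n)⟩)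
  · constructor
    · rw [← hpa]; exact (PL0.strictMono _).monotone hd.1
    · conv_rhs => rw [← hpc]
      exact (PL0.strictMono _).monotone hd.2

theorem strictMono_homeomorph_one {f : unitInterval ≃ₜ unitInterval} (hf : StrictMono f) :
    f 1 = 1 := by
  apply le_antisymm unitInterval.le_one'
  have := hf.monotone (unitInterval.le_one' : f.symm 1 ≤ 1)
  simpa using this

/-! ### Orbitals, nesting, and the relations for `f₀` and `f₁`. -/

/-- Every point of the support lies in an orbital. -/
theorem exists_isOrbital (f : PL0) {x : unitInterval} (hx : f.1 x ≠ x) :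
    ∃ u v, IsOrbital f u v ∧ x ∈ Ioo u v := by
  have hcl : IsClosed {y | f.1 y = y} := isClosed_eq f.1.continuous continuous_id
  -- The endpoints are the nearest fixed points on either side; they exist because the fixed set is
  -- compact and contains 0 and 1.
  obtain ⟨u, ⟨hu, hux⟩, hmax⟩ := (hcl.inter (isClosed_Iic (a := x))).isCompact.exists_isGreatest
    ⟨0, strictMono_homeomorph_zero (PL0.strictMono f), unitInterval.nonneg'⟩
  obtain ⟨v, ⟨hv, hxv⟩, hmin⟩ := (hcl.inter (isClosed_Ici (a := x))).isCompact.exists_isLeast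
    ⟨1, strictMono_homeomorph_one (PL0.strictMono f), unitInterval.le_one'⟩
  have hux' : u < x := lt_of_le_of_ne hux (by rintro rfl; exact hx hu)
  have hxv' : x < v := lt_of_le_of_ne hxv (by rintro rfl; exact hx hv)
  refine ⟨u, v, ⟨hux'.trans hxv', hu, hv, fun y hy hfy => ?_⟩, hux', hxv'⟩
  rcases le_total y x with h | h
  · exact hy.1.not_ge (hmax ⟨hfy, h⟩)
  · exact hy.2.not_ge (hmin ⟨hfy, h⟩)

theorem IsOrbital.isUpBump_or_isDownBump {f : PL0} {a c : unitInterval} (h : IsOrbital f a c) :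
    IsUpBump f a c ∨ IsDownBump f a c := by
  by_contra! hcon
  simp only [IsUpBump, IsDownBump, h, true_and, not_forall, not_lt] at hcon
  obtain ⟨⟨x, hx, hx'⟩, ⟨y, hy, hy'⟩⟩ := hcon
  obtain ⟨z, hz, e⟩ := isPreconnected_Ioo.intermediate_value₂ hx hy f.1.continuous.continuousOn
    continuousOn_id hx' hy'
  exact h.2.2.2 z hz e

section Nested

variable {f₀ f₁ : PL0}

/-- If `f₀` moved f₁ x, the orbital of `f₁` containing both x and f₁ x would meet an orbital of
`f₀`, hence lie in it, and `f₀` would move x. -/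
theorem PL0.fixed_of_nested
    (horb : ∀ a c b d : unitInterval, IsOrbital f₀ a c → IsOrbital f₁ b d →
      Ioo b d ⊆ Ioo a c ∨ Ioo a c ∩ Ioo b d = ∅) {x : unitInterval} (h0 : f₀.1 x = x) :
    f₀.1 (f₁.1 x) = f₁.1 x := by
  by_cases h1 : f₁.1 x = x
  · rwa [h1]
  · by_contra hne
    obtain ⟨u, v, huv, hx⟩ := exists_isOrbital f₁ h1
    obtain ⟨a, c, hac, hx'⟩ := exists_isOrbital f₀ hne
    have hmem : f₁.1 x ∈ Ioo u v := by
      constructor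
      · rw [← huv.2.1]; exact (PL0.strictMono f₁) hx.1
      · rw [← huv.2.2.1]; exact (PL0.strictMono f₁) hx.2
    rcases horb a c u v hac huv with h | h
    · exact hac.2.2.2 x (h hx) h0
    · exact (eq_empty_iff_forall_notMem.1 h) _ ⟨hx', hmem⟩

/-- An orbital of `f₁` around an endpoint would overlap (a, c) without being contained in it. -/
theorem PL0.fixed_endpoints_of_nested
    (horb : ∀ a c b d : unitInterval, IsOrbital f₀ a c → IsOrbital f₁ b d →
      Ioo b d ⊆ Ioo a c ∨ Ioo a c ∩ Ioo b d = ∅) {a c : unitInterval} (hac : IsOrbital f₀ a c) :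
    f₁.1 a = a ∧ f₁.1 c = c := by
  constructor
  · by_contra hne
    obtain ⟨u, v, huv, hx⟩ := exists_isOrbital f₁ hne
    rcases horb a c u v hac huv with h | h
    · exact (h hx).1.false
    · obtain ⟨z, hz, hz'⟩ := exists_between (lt_min hx.2 hac.1)
      exact (eq_empty_iff_forall_notMem.1 h) z
        ⟨⟨hz, hz'.trans_le (min_le_right _ _)⟩, hx.1.trans hz, hz'.trans_le (min_le_left _ _)⟩
  · by_contra hne
    obtain ⟨u, v, huv, hx⟩ := exists_isOrbital f₁ hne
    rcases horb a c u v hac huv with h | h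
    · exact (h hx).2.false
    · obtain ⟨z, hz, hz'⟩ := exists_between (max_lt hx.1 hac.1)
      exact (eq_empty_iff_forall_notMem.1 h) z
        ⟨⟨(le_max_right _ _).trans_lt hz, hz'⟩, (le_max_left _ _).trans_lt hz, hz'.trans hx.2⟩

/-- Inside an orbital of `f₀` that is not an orbital of `f₁`, every moved point of `f₁` lies in one
of the listed orbitals. -/
theorem IsOrbitalList.exists_mem
    (horb : ∀ a c b d : unitInterval, IsOrbital f₀ a c → IsOrbital f₁ b d →
      Ioo b d ⊆ Ioo a c ∨ Ioo a c ∩ Ioo b d = ∅) {a c e : unitInterval} (hac : IsOrbital f₀ a c)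
    {n : ℕ} {b d : Fin (n + 1) → unitInterval} (hl : IsOrbitalList f₁ a c b d)
    (he : e ∈ Ioo a c) (hfe : f₁.1 e = e) {x : unitInterval} (hx : x ∈ Ioo a c)
    (hne : f₁.1 x ≠ x) : ∃ i, x ∈ Ioo (b i) (d i) := by
  obtain ⟨u, v, huv, hxuv⟩ := exists_isOrbital f₁ hne
  rcases horb a c u v hac huv with h | h
  -- The fixed point e makes the inclusion proper.
  · obtain ⟨i, rfl, rfl⟩ := hl.complete u v huv ⟨h, fun h' => huv.2.2.2 e (h' he) hfe⟩
    exact ⟨i, hxuv⟩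
  · exact absurd ⟨hx, hxuv⟩ (eq_empty_iff_forall_notMem.1 h x)

theorem isClosed_agree (f₀ f₁ : PL0) : IsClosed {x | f₀.1 x = f₁.1 x} :=
  isClosed_eq f₀.1.continuous f₁.1.continuous

/-- The conditions quantify over minimal points of agreement, so one has to exist; this follows
because the agreement set is closed. -/
theorem exists_isLeast_agreeUpTo (f₀ f₁ : PL0) {c : unitInterval} (h : f₀.1 c = f₁.1 c) :
    ∃ p, IsLeast (agreeUpTo f₀ f₁ c) p := by
  have hne : (agreeUpTo f₀ f₁ c).Nonempty := ⟨c, le_rfl, fun x hx => by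
    obtain rfl : x = c := le_antisymm hx.2 hx.1
    exact h⟩
  have hbdd : BddBelow (agreeUpTo f₀ f₁ c) := ⟨0, fun x _ => unitInterval.nonneg'⟩
  have hglb := isGLB_csInf hne hbdd
  set p := sInf (agreeUpTo f₀ f₁ c)
  refine ⟨p, ⟨hglb.1 hne.some_mem |>.trans hne.some_mem.1, ?_⟩, hglb.1⟩
  have hIoc : Ioc p c ⊆ {x | f₀.1 x = f₁.1 x} := by
    intro x hx
    obtain ⟨q, hq, hqx⟩ := (isGLB_lt_iff hglb).1 hx.1
    exact hq.2 ⟨hqx.le, hx.2⟩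
  rcases (hglb.1 hne.some_mem |>.trans hne.some_mem.1).eq_or_lt with e | hlt
  · intro x hx
    obtain rfl : x = c := le_antisymm hx.2 (e ▸ hx.1)
    exact h
  · intro x hx
    have := (isClosed_agree f₀ f₁).closure_subset_iff.2 hIoc
    rw [closure_Ioc hlt.ne] at this
    exact this hx

theorem exists_isGreatest_agreeFrom (f₀ f₁ : PL0) {a : unitInterval} (h : f₀.1 a = f₁.1 a) :
    ∃ p, IsGreatest (agreeFrom f₀ f₁ a) p := by
  have hne : (agreeFrom f₀ f₁ a).Nonempty := ⟨a, le_rfl, fun x hx => by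
    obtain rfl : x = a := le_antisymm hx.2 hx.1
    exact h⟩
  have hbdd : BddAbove (agreeFrom f₀ f₁ a) := ⟨1, fun x _ => unitInterval.le_one'⟩
  have hlub := isLUB_csSup hne hbdd
  set p := sSup (agreeFrom f₀ f₁ a)
  refine ⟨p, ⟨hne.some_mem.1.trans (hlub.1 hne.some_mem), ?_⟩, hlub.1⟩
  have hIco : Ico a p ⊆ {x | f₀.1 x = f₁.1 x} := by
    intro x hx
    obtain ⟨q, hq, hqx⟩ := (lt_isLUB_iff hlub).1 hx.2
    exact hq.2 ⟨hx.1, hqx.le⟩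
  rcases (hne.some_mem.1.trans (hlub.1 hne.some_mem)).eq_or_lt with e | hlt
  · intro x hx
    obtain rfl : x = a := le_antisymm (e ▸ hx.2) hx.1
    exact h
  · intro x hx
    have := (isClosed_agree f₀ f₁).closure_subset_iff.2 hIco
    rw [closure_Ico hlt.ne] at this
    exact this hx

/-- Split at b 0: no inner orbital starts earlier, so `f₁` is trivial on [a, b 0], while
`cond_extra` gives agreement on all of [f₀ (b 0), c]. -/
theorem IsOrbitalList.relAt_of_isUpBump
    (horb : ∀ a c b d : unitInterval, IsOrbital f₀ a c → IsOrbital f₁ b d →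
      Ioo b d ⊆ Ioo a c ∨ Ioo a c ∩ Ioo b d = ∅) {a c : unitInterval} (hac : IsUpBump f₀ a c)
    {n : ℕ} {b d : Fin (n + 1) → unitInterval} (hl : IsOrbitalList f₁ a c b d)
    (hnice : NiceUp f₀ f₁ a c b d) {x : unitInterval} (hx : x ∈ Icc a c) :
    PL0.RelAt f₀ f₁ x := by
  obtain ⟨h1a, h1c⟩ := PL0.fixed_endpoints_of_nested horb hac.1
  obtain ⟨-, h0a, h0c, -⟩ := hac.1
  obtain ⟨p, hp⟩ := exists_isLeast_agreeUpTo f₀ f₁ (h0c.trans h1c.symm)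
  obtain ⟨hlt, hfb, -, -⟩ := hl.orbital 0
  have hbc : b 0 < c := by
    obtain ⟨z, hz, hz'⟩ := exists_between hlt
    exact hz.trans ((hl.subset 0).1 ⟨hz, hz'⟩).2
  have hb : b 0 ∈ Ioo a c := ⟨hnice.cond_i, hbc⟩
  refine PL0.relAt_of_up h0a h0c h1a h1c ⟨hb.1.le, hb.2.le⟩ (hac.2 _ hb).le ?_ ?_ hx
  · intro y hy
    rcases hy.1.eq_or_lt with rfl | h
    · exact h1a
    · by_contra hne
      obtain ⟨i, hi⟩ := hl.exists_mem horb hac.1 hb hfb ⟨h, hy.2.trans_lt hbc⟩ hne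
      exact (hi.1.trans_le hy.2).not_ge (hl.increasing.monotone (Fin.zero_le i))
  · intro y hy
    exact hp.1.2 ⟨(hnice.cond_extra p hp).trans hy.1, hy.2⟩

/-- Disjoint orbitals are ordered by their right endpoints as well. -/
theorem IsOrbitalList.monotone_right {a c : unitInterval} {n : ℕ}
    {b d : Fin (n + 1) → unitInterval} (hl : IsOrbitalList f₁ a c b d) : Monotone d := by
  intro i j hij
  rcases hij.eq_or_lt with rfl | h
  · exact le_rfl
  · have hb := hl.increasing h
    refine le_trans ?_ (hl.orbital j).1.le
    by_contra! hlt
    exact (hl.orbital i).2.2.2 _ ⟨hb, hlt⟩ (hl.orbital j).2.1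

/-- The mirror argument, split at the right end of the last inner orbital. -/
theorem IsOrbitalList.relAt_of_isDownBump
    (horb : ∀ a c b d : unitInterval, IsOrbital f₀ a c → IsOrbital f₁ b d →
      Ioo b d ⊆ Ioo a c ∨ Ioo a c ∩ Ioo b d = ∅) {a c : unitInterval} (hac : IsDownBump f₀ a c)
    {n : ℕ} {b d : Fin (n + 1) → unitInterval} (hl : IsOrbitalList f₁ a c b d)
    (hnice : NiceDown f₀ f₁ a c b d) {x : unitInterval} (hx : x ∈ Icc a c) :
    PL0.RelAt f₀ f₁ x := by
  obtain ⟨h1a, h1c⟩ := PL0.fixed_endpoints_of_nested horb hac.1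
  obtain ⟨-, h0a, h0c, -⟩ := hac.1
  obtain ⟨p, hp⟩ := exists_isGreatest_agreeFrom f₀ f₁ (h0a.trans h1a.symm)
  obtain ⟨hlt, -, hfd, -⟩ := hl.orbital (Fin.last n)
  have had : a < d (Fin.last n) := by
    obtain ⟨z, hz, hz'⟩ := exists_between hlt
    exact ((hl.subset (Fin.last n)).1 ⟨hz, hz'⟩).1.trans hz'
  have hd : d (Fin.last n) ∈ Ioo a c := ⟨had, hnice.cond_i⟩
  refine PL0.relAt_of_down h0a h0c h1a h1c ⟨hd.1.le, hd.2.le⟩ (hac.2 _ hd).le ?_ ?_ hx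
  · intro y hy
    rcases hy.2.eq_or_lt with rfl | h
    · exact h1c
    · by_contra hne
      obtain ⟨i, hi⟩ := hl.exists_mem horb hac.1 hd hfd ⟨had.trans_le hy.1, h⟩ hne
      exact (hy.1.trans_lt hi.2).not_ge (hl.monotone_right (Fin.le_last i))
  · intro y hy
    exact hp.1.2 ⟨hy.1, hy.2.trans (hnice.cond_extra p hp)⟩

end Nested

/-! ### The standard generators satisfy the relations and do not commute. -/

theorem x0_apply (t : unitInterval) : ((x0.1.1 t : unitInterval) : ℝ) =
    if (t : ℝ) ≤ 1 / 4 then 2 * (t : ℝ) else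
      if (t : ℝ) ≤ 1 / 2 then (t : ℝ) + 1 / 4 else (t : ℝ) / 2 + 1 / 2 := x0Homeo_apply t

theorem x1_apply (t : unitInterval) : ((x1.1.1 t : unitInterval) : ℝ) =
    if (t : ℝ) ≤ 1 / 2 then (t : ℝ) else
      if (t : ℝ) ≤ 5 / 8 then 2 * (t : ℝ) - 1 / 2 else
      if (t : ℝ) ≤ 3 / 4 then (t : ℝ) + 1 / 8 else (t : ℝ) / 2 + 1 / 2 := x1Homeo_apply t

theorem thompsonRel_x0_x1 : ThompsonRel x0 x1 := by
  have h : ThompsonRel x0.1 x1.1 := by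
    refine PL0.thompsonRel_of_relAt fun x => ?_
    -- [0, 1] behaves as a single up-bump: x₁ is trivial on [0, 1/2], x₀ sends 1/2 to 3/4, and the
    -- two agree on [3/4, 1].
    refine PL0.relAt_of_up (a := 0) (c := 1) (b := ⟨1 / 2, by norm_num, by norm_num⟩)
      (strictMono_homeomorph_zero (PL0.strictMono _)) (strictMono_homeomorph_one (PL0.strictMono _))
      (strictMono_homeomorph_zero (PL0.strictMono _)) (strictMono_homeomorph_one (PL0.strictMono _))
      ⟨unitInterval.nonneg', unitInterval.le_one'⟩ ?_ ?_ ?_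
      ⟨unitInterval.nonneg', unitInterval.le_one'⟩
    · rw [← Subtype.coe_le_coe, x0_apply]; norm_num
    · intro y hy
      have hy' : (y : ℝ) ≤ 1 / 2 := hy.2
      rw [Subtype.ext_iff, x1_apply, if_pos hy']
    · intro y hy
      have hy' := Subtype.coe_le_coe.2 hy.1
      rw [x0_apply] at hy'
      norm_num at hy'
      rw [Subtype.ext_iff, x0_apply, x1_apply]
      split_ifs <;> linarith
  intro n hn
  exact Subtype.ext (h n hn)

theorem not_commute_x0_x1 : ¬ Commute x0 x1 := by
  intro h
  have h1 : ((x0.1.1 (x1.1.1 ⟨1 / 2, by norm_num, by norm_num⟩) : unitInterval) : ℝ) =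
      ((x1.1.1 (x0.1.1 ⟨1 / 2, by norm_num, by norm_num⟩) : unitInterval) : ℝ) :=
    congrArg (fun g : ThompsonF => ((g.1.1 ⟨1 / 2, by norm_num, by norm_num⟩ : unitInterval) : ℝ))
      h.eq
  rw [x0_apply, x1_apply, x1_apply, x0_apply] at h1
  norm_num at h1

/-! ### Binary addresses of standard dyadic intervals, and the comb. -/

/-- The affine map of `[0,1]` onto its left or right half. -/
noncomputable def halfMap (b : Bool) (t : unitInterval) : unitInterval :=
  ⟨((if b then 1 else 0) + (t : ℝ)) / 2, by
    have h0 := t.2.1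
    have h1 := t.2.2
    constructor <;> split_ifs <;> linarith⟩

/-- The affine map of `[0,1]` onto the standard dyadic interval with the given address. -/
noncomputable def dyadicMap : List Bool → unitInterval → unitInterval
  | [], t => t
  | b :: w, t => halfMap b (dyadicMap w t)

theorem dyadicMap_append (u v : List Bool) (t : unitInterval) :
    dyadicMap (u ++ v) t = dyadicMap u (dyadicMap v t) := by
  induction u with
  | nil => rfl
  | cons b u ih => simp [dyadicMap, ih]

@[simp]
theorem dyadicMap_nil (t : unitInterval) : dyadicMap [] t = t := rfl

theorem coe_dyadicMap_true (w : List Bool) (t : unitInterval) :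
    (dyadicMap (true :: w) t : ℝ) = (1 + dyadicMap w t) / 2 := by
  simp [dyadicMap, halfMap]

theorem coe_dyadicMap_false (w : List Bool) (t : unitInterval) :
    (dyadicMap (false :: w) t : ℝ) = dyadicMap w t / 2 := by
  simp [dyadicMap, halfMap]

theorem dyadicMap_strictMono (w : List Bool) : StrictMono (dyadicMap w) := by
  induction w with
  | nil => exact strictMono_id
  | cons b w ih =>
    intro s t hst
    have h : (dyadicMap w s : ℝ) < dyadicMap w t := ih hst
    change (dyadicMap (b :: w) s : ℝ) < dyadicMap (b :: w) t
    cases b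
    · rw [coe_dyadicMap_false, coe_dyadicMap_false]; linarith
    · rw [coe_dyadicMap_true, coe_dyadicMap_true]; linarith

theorem exists_dyadicMap_eq (w : List Bool) :
    ∃ a : ℕ, ∀ t : unitInterval, (dyadicMap w t : ℝ) = (a + t) / 2 ^ w.length := by
  induction w with
  | nil => exact ⟨0, fun t => by simp [dyadicMap]⟩
  | cons b w ih =>
    obtain ⟨a, ha⟩ := ih
    cases b
    · refine ⟨a, fun t => ?_⟩
      rw [coe_dyadicMap_false, ha, List.length_cons, pow_succ]
      field_simp
    · refine ⟨a + 2 ^ w.length, fun t => ?_⟩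
      rw [coe_dyadicMap_true, ha, List.length_cons, pow_succ]
      push_cast
      field_simp
      ring

theorem exists_word_of_lt (m a : ℕ) (h : a < 2 ^ m) :
    ∃ w : List Bool, w.length = m ∧
      ∀ t : unitInterval, (dyadicMap w t : ℝ) = (a + t) / 2 ^ m := by
  induction m generalizing a with
  | zero =>
    obtain rfl : a = 0 := by simpa using h
    exact ⟨[], rfl, fun t => by simp [dyadicMap]⟩
  | succ m ih =>
    rcases lt_or_ge a (2 ^ m) with h' | h'
    · obtain ⟨w, hw, e⟩ := ih a h'
      refine ⟨false :: w, by simp [hw], fun t => ?_⟩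
      rw [coe_dyadicMap_false, e, pow_succ]
      field_simp
    · obtain ⟨w, hw, e⟩ := ih (a - 2 ^ m) (by rw [pow_succ] at h; omega)
      refine ⟨true :: w, by simp [hw], fun t => ?_⟩
      rw [coe_dyadicMap_true, e, pow_succ, Nat.cast_sub h']
      push_cast
      field_simp
      ring

theorem dyadicMap_zero_lt_one (w : List Bool) : (dyadicMap w 0 : ℝ) < 1 :=
  lt_of_lt_of_le (dyadicMap_strictMono w zero_lt_one) (dyadicMap w 1).2.2

/-- The address of the interval `[1 - 2⁻ⁿ, 1 - 2⁻⁽ⁿ⁺¹⁾]`. -/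
def combWord (n : ℕ) : List Bool := List.replicate n true ++ [false]

theorem combWord_succ (n : ℕ) : combWord (n + 1) = true :: combWord n := rfl

theorem replicate_append_combWord (n k : ℕ) :
    List.replicate n true ++ combWord k = combWord (n + k) := by
  simp [combWord, ← List.append_assoc, List.replicate_append_replicate]

theorem dyadicMap_combWord_zero_lt (n : ℕ) :
    dyadicMap (combWord n) 0 < dyadicMap (combWord (n + 1)) 0 := by
  induction n with
  | zero =>
    change (dyadicMap (combWord 0) 0 : ℝ) < dyadicMap (combWord 1) 0
    simp [combWord, coe_dyadicMap_true, coe_dyadicMap_false, dyadicMap_nil]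
  | succ n ih =>
    have h : (dyadicMap (combWord n) 0 : ℝ) < dyadicMap (combWord (n + 1)) 0 := ih
    change (dyadicMap (combWord (n + 1)) 0 : ℝ) < dyadicMap (combWord (n + 1 + 1)) 0
    rw [combWord_succ, combWord_succ (n + 1), coe_dyadicMap_true, coe_dyadicMap_true]
    linarith

theorem strictMono_combWord : StrictMono fun n => dyadicMap (combWord n) 0 :=
  strictMono_nat_of_lt_succ dyadicMap_combWord_zero_lt

theorem dyadicMap_combWord_one (n : ℕ) :
    dyadicMap (combWord n) 1 = dyadicMap (combWord (n + 1)) 0 := by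
  induction n with
  | zero =>
    apply Subtype.ext
    simp [combWord, coe_dyadicMap_true, coe_dyadicMap_false, dyadicMap_nil]
  | succ n ih =>
    rw [combWord_succ, combWord_succ (n + 1)]
    simp only [dyadicMap, ih]

theorem eq_replicate_false_of_dyadicMap_zero (w : List Bool) (h : (dyadicMap w 0 : ℝ) = 0) :
    w = List.replicate w.length false := by
  induction w with
  | nil => rfl
  | cons b w ih =>
    cases b
    · rw [coe_dyadicMap_false] at h
      rw [List.length_cons, List.replicate_succ, ← ih (by linarith)]
    · rw [coe_dyadicMap_true] at h
      have := (dyadicMap w 0).2.1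
      linarith

theorem eq_replicate_true_of_dyadicMap_one (w : List Bool) (h : (dyadicMap w 1 : ℝ) = 1) :
    w = List.replicate w.length true := by
  induction w with
  | nil => rfl
  | cons b w ih =>
    cases b
    · rw [coe_dyadicMap_false] at h
      have := (dyadicMap w 1).2.2
      linarith
    · rw [coe_dyadicMap_true] at h
      rw [List.length_cons, List.replicate_succ, ← ih (by linarith)]

theorem dyadicMap_replicate_true_one (n : ℕ) : dyadicMap (List.replicate n true) 1 = 1 := by
  induction n with
  | zero => rfl
  | succ n ih =>
    apply Subtype.ext
    rw [List.replicate_succ, coe_dyadicMap_true, ih]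
    norm_num

theorem exists_eq_combWord_append {i : ℕ} {u : List Bool}
    (h : (dyadicMap u 0 : ℝ) = dyadicMap (combWord i) 0) (h1 : (dyadicMap u 1 : ℝ) < 1) :
    ∃ m, u = combWord i ++ List.replicate m false := by
  induction i generalizing u with
  | zero =>
    match u with
    | [] => simp [dyadicMap] at h1
    | true :: u =>
      have := (dyadicMap u 0).2.1
      rw [coe_dyadicMap_true] at h
      simp [combWord, coe_dyadicMap_false, dyadicMap_nil] at h
      linarith
    | false :: u =>
      rw [coe_dyadicMap_false] at h
      simp [combWord, coe_dyadicMap_false, dyadicMap_nil] at h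
      refine ⟨u.length, ?_⟩
      rw [← eq_replicate_false_of_dyadicMap_zero u (by rw [h]; rfl)]
      rfl
  | succ i ih =>
    rw [combWord_succ, coe_dyadicMap_true] at h
    have h0 := (dyadicMap (combWord i) 0).2.1
    match u with
    | [] => simp [dyadicMap] at h1
    | true :: u =>
      rw [coe_dyadicMap_true] at h h1
      obtain ⟨m, rfl⟩ := ih (u := u) (by linarith) (by linarith)
      exact ⟨m, rfl⟩
    | false :: u =>
      rw [coe_dyadicMap_false] at h
      have := dyadicMap_zero_lt_one u
      linarith

/-- These three families are exactly where xᵢ acts by replacing a prefix of the address. -/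
theorem exists_append_of_dyadicMap_combWord_lt {i : ℕ} {u : List Bool}
    (h : (dyadicMap (combWord i) 0 : ℝ) < dyadicMap u 0) :
    ∃ w, u = combWord i ++ false :: w ∨ u = combWord i ++ true :: w ∨
      u = List.replicate i true ++ true :: w := by
  induction i generalizing u with
  | zero =>
    match u with
    | [] =>
      have := (dyadicMap (combWord 0) 0).2.1
      simp only [dyadicMap, Icc.coe_zero] at h
      linarith
    | [false] => exact absurd h (lt_irrefl _)
    | false :: false :: w => exact ⟨w, Or.inl rfl⟩
    | false :: true :: w => exact ⟨w, Or.inr (Or.inl rfl)⟩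
    | true :: w => exact ⟨w, Or.inr (Or.inr rfl)⟩
  | succ i ih =>
    rw [combWord_succ, coe_dyadicMap_true] at h
    have h0 := (dyadicMap (combWord i) 0).2.1
    match u with
    | [] =>
      simp only [dyadicMap, Icc.coe_zero] at h
      linarith
    | false :: u =>
      rw [coe_dyadicMap_false] at h
      have := dyadicMap_zero_lt_one u
      linarith
    | true :: u =>
      rw [coe_dyadicMap_true] at h
      obtain ⟨w, rfl | rfl | rfl⟩ := ih (u := u) (by linarith)
      · exact ⟨w, Or.inl rfl⟩
      · exact ⟨w, Or.inr (Or.inl rfl)⟩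
      · exact ⟨w, Or.inr (Or.inr rfl)⟩

theorem exists_mem_combWord {t : unitInterval} (ht : (t : ℝ) < 1) :
    ∃ n s, dyadicMap (combWord n) s = t := by
  -- On the right half, t ↦ 2t - 1 doubles the distance to 1, so this exponent bounds the number of
  -- doublings.
  obtain ⟨n, hn⟩ := exists_pow_lt_of_lt_one (sub_pos.2 ht) (by norm_num : (1 / 2 : ℝ) < 1)
  induction n generalizing t with
  | zero =>
    have := t.2.1
    norm_num at hn
    linarith
  | succ n ih =>
    have h0 := t.2.1
    rcases le_total (t : ℝ) (1 / 2) with h | h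
    · refine ⟨0, ⟨2 * t, by linarith, by linarith⟩, Subtype.ext ?_⟩
      simp [combWord, coe_dyadicMap_false, dyadicMap_nil]
    · rw [pow_succ] at hn
      obtain ⟨k, s, e⟩ := ih (t := ⟨2 * t - 1, by linarith, by linarith⟩)
        (by change 2 * (t : ℝ) - 1 < 1; linarith)
        (by change _ < 1 - (2 * (t : ℝ) - 1); linarith)
      refine ⟨k + 1, s, Subtype.ext ?_⟩
      rw [combWord_succ, coe_dyadicMap_true, e]
      change (1 + (2 * (t : ℝ) - 1)) / 2 = t
      ring

/-! ### Prefix replacement by the generators xₙ. -/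

/-- The element `f` maps the interval with address `u` affinely onto the one with address `v`. -/
def MapsWord (f : ThompsonF) (u v : List Bool) : Prop :=
  ∀ t, f.1.1 (dyadicMap u t) = dyadicMap v t

namespace MapsWord

theorem one (u : List Bool) : MapsWord 1 u u := fun _ => rfl

theorem mul {f g : ThompsonF} {u v w : List Bool} (hf : MapsWord f v w) (hg : MapsWord g u v) :
    MapsWord (f * g) u w := fun t => by
  change f.1.1 (g.1.1 (dyadicMap u t)) = _
  rw [hg t, hf t]

theorem inv {f : ThompsonF} {u v : List Bool} (hf : MapsWord f u v) : MapsWord f⁻¹ v u :=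
  fun t => by
    change f.1.1.symm (dyadicMap v t) = _
    rw [← hf t]
    exact f.1.1.symm_apply_apply _

theorem append {f : ThompsonF} {u v : List Bool} (hf : MapsWord f u v) (w : List Bool) :
    MapsWord f (u ++ w) (v ++ w) := fun t => by
  rw [dyadicMap_append, dyadicMap_append, hf]

end MapsWord

theorem mapsWord_x0_left : MapsWord x0 [false, false] [false] := fun t => by
  have h0 := t.2.1
  have h1 := t.2.2
  apply Subtype.ext
  rw [x0_apply]
  simp only [coe_dyadicMap_false, dyadicMap_nil]
  split_ifs <;> linarith

theorem mapsWord_x0_mid : MapsWord x0 [false, true] [true, false] := fun t => by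
  have h0 := t.2.1
  have h1 := t.2.2
  apply Subtype.ext
  rw [x0_apply]
  simp only [coe_dyadicMap_true, coe_dyadicMap_false, dyadicMap_nil]
  split_ifs <;> linarith

theorem mapsWord_x0_right : MapsWord x0 [true] [true, true] := fun t => by
  have h0 := t.2.1
  have h1 := t.2.2
  apply Subtype.ext
  rw [x0_apply]
  simp only [coe_dyadicMap_true, dyadicMap_nil]
  split_ifs <;> linarith

theorem mapsWord_x1_fix : MapsWord x1 [false] [false] := fun t => by
  have h0 := t.2.1
  have h1 := t.2.2
  apply Subtype.ext
  rw [x1_apply]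
  simp only [coe_dyadicMap_false, dyadicMap_nil]
  split_ifs <;> linarith

theorem mapsWord_x1_left : MapsWord x1 [true, false, false] [true, false] := fun t => by
  have h0 := t.2.1
  have h1 := t.2.2
  apply Subtype.ext
  rw [x1_apply]
  simp only [coe_dyadicMap_true, coe_dyadicMap_false, dyadicMap_nil]
  split_ifs <;> linarith

theorem mapsWord_x1_mid : MapsWord x1 [true, false, true] [true, true, false] := fun t => by
  have h0 := t.2.1
  have h1 := t.2.2
  apply Subtype.ext
  rw [x1_apply]
  simp only [coe_dyadicMap_true, coe_dyadicMap_false, dyadicMap_nil]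
  split_ifs <;> linarith

theorem mapsWord_x1_right : MapsWord x1 [true, true] [true, true, true] := fun t => by
  have h0 := t.2.1
  have h1 := t.2.2
  apply Subtype.ext
  rw [x1_apply]
  simp only [coe_dyadicMap_true, dyadicMap_nil]
  split_ifs <;> linarith

/-- The generators `xₙ` of Thompson's group `F`. -/
noncomputable def xGen : ℕ → ThompsonF
  | 0 => x0
  | 1 => x1
  | n + 2 => x0 * xGen (n + 1) * x0⁻¹

theorem xGen_mem (n : ℕ) : xGen n ∈ Subgroup.closure ({x0, x1} : Set ThompsonF) := by
  have h0 : x0 ∈ Subgroup.closure ({x0, x1} : Set ThompsonF) := Subgroup.subset_closure (by simp)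
  match n with
  | 0 => exact h0
  | 1 => exact Subgroup.subset_closure (Or.inr rfl)
  | n + 2 => exact mul_mem (mul_mem h0 (xGen_mem (n + 1))) (inv_mem h0)

/-- Conjugating by x₀ prepends one `true`, as x₀ carries the address 1 to 11. -/
theorem mapsWord_xGen_of_x1 {w w' : List Bool} (h : MapsWord x1 (true :: w) (true :: w')) (n : ℕ) :
    MapsWord (xGen (n + 1)) (List.replicate (n + 1) true ++ w)
      (List.replicate (n + 1) true ++ w') := by
  induction n with
  | zero => exact h
  | succ n ih =>
    have e := fun v => mapsWord_x0_right.append (List.replicate n true ++ v)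
    exact ((e w').mul ih).mul (e w).inv

/-- x₀⁻¹ takes the comb intervals 0 and 1 to the two halves of interval 0 and lowers all later
indices by one. -/
theorem mapsWord_xGen_fix {i n : ℕ} (h : i < n) : MapsWord (xGen n) (combWord i) (combWord i) := by
  induction n generalizing i with
  | zero => omega
  | succ n ih =>
    cases n with
    | zero =>
      obtain rfl : i = 0 := by omega
      exact mapsWord_x1_fix
    | succ n =>
      match i with
      | 0 =>
        exact (mapsWord_x0_left.mul ((ih (i := 0) (by omega)).append [false])).mul
          mapsWord_x0_left.inv
      | 1 =>
        exact (mapsWord_x0_mid.mul ((ih (i := 0) (by omega)).append [true])).mul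
          mapsWord_x0_mid.inv
      | i + 2 =>
        have e := mapsWord_x0_right.append (combWord i)
        exact (e.mul (ih (i := i + 1) (by omega))).mul e.inv

theorem mapsWord_xGen_left (n : ℕ) : MapsWord (xGen n) (combWord n ++ [false]) (combWord n) := by
  cases n with
  | zero => exact mapsWord_x0_left
  | succ n =>
    have := mapsWord_xGen_of_x1 mapsWord_x1_left n
    simpa [combWord] using this

theorem mapsWord_xGen_mid (n : ℕ) :
    MapsWord (xGen n) (combWord n ++ [true]) (combWord (n + 1)) := by
  cases n with
  | zero => exact mapsWord_x0_mid
  | succ n =>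
    have := mapsWord_xGen_of_x1 mapsWord_x1_mid n
    rw [← replicate_append_combWord (n + 1) 1]
    simpa [combWord] using this

theorem mapsWord_xGen_right (n : ℕ) :
    MapsWord (xGen n) (List.replicate n true ++ [true]) (List.replicate n true ++ [true, true]) := by
  cases n with
  | zero => exact mapsWord_x0_right
  | succ n => exact mapsWord_xGen_of_x1 mapsWord_x1_right n

theorem mapsWord_xGen_comb (n k : ℕ) :
    MapsWord (xGen n) (combWord (n + 1 + k)) (combWord (n + 2 + k)) := by
  have := (mapsWord_xGen_right n).append (combWord k)
  rw [← replicate_append_combWord (n + 1) k, ← replicate_append_combWord (n + 2) k]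
  simpa [List.replicate_add] using this

/-! ### Adapted dyadic subdivisions for elements of F. -/

/-- The interval with address `v` has a finite dyadic subdivision into intervals that `f` maps
affinely onto standard dyadic intervals. -/
inductive Subdividable (f : ThompsonF) : List Bool → Prop
  | maps {v u : List Bool} : MapsWord f v u → Subdividable f v
  | split {v : List Bool} : Subdividable f (v ++ [false]) → Subdividable f (v ++ [true]) →
      Subdividable f v

theorem Subdividable.of_extensions {f : ThompsonF} (r : ℕ) {v : List Bool}
    (h : ∀ w : List Bool, w.length = r → Subdividable f (v ++ w)) : Subdividable f v := by
  induction r generalizing v with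
  | zero => simpa using h [] rfl
  | succ r ih =>
    refine .split (ih fun w hw => ?_) (ih fun w hw => ?_)
    · simpa using h (false :: w) (by simp [hw])
    · simpa using h (true :: w) (by simp [hw])

theorem exists_common_denominator {S : Set unitInterval} (hS : S.Finite)
    (hSd : ∀ s ∈ S, IsDyadic (s : ℝ)) :
    ∃ N : ℕ, ∀ s ∈ S, ∀ L ≥ N, ∃ m : ℤ, (s : ℝ) = m / 2 ^ L := by
  choose! m n h using hSd
  obtain ⟨N, hN⟩ := (hS.image n).bddAbove
  refine ⟨N, fun s hs L hL => ⟨m s * 2 ^ (L - n s), ?_⟩⟩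
  have hle : n s ≤ L := (hN (mem_image_of_mem n hs)).trans hL
  obtain ⟨k, rfl⟩ := Nat.exists_eq_add_of_le hle
  rw [h s hs, Nat.add_sub_cancel_left, pow_add]
  push_cast
  field_simp

theorem Subdividable.of_affine {f : ThompsonF} {v : List Bool} {e : ℤ}
    (hd : IsDyadic (f.1.1 (dyadicMap v 0) : ℝ))
    (h : ∀ t, (f.1.1 (dyadicMap v t) : ℝ) =
      f.1.1 (dyadicMap v 0) + 2 ^ e * ((t : ℝ) / 2 ^ v.length)) : Subdividable f v := by
  obtain ⟨b, c, hbc⟩ := hd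
  -- The image starts at b / 2^c. At this depth image pieces have length 2^-(c + k) with k = |e| +
  -- |v| - e ≥ 0, and the starting point lies on the same grid, so the pieces are standard.
  refine .of_extensions (c + e.natAbs) fun w hw => ?_
  obtain ⟨a, ha⟩ := exists_dyadicMap_eq w
  obtain ⟨k, hk⟩ : ∃ k : ℕ, ((c + k : ℕ) : ℤ) = c + e.natAbs + v.length - e :=
    ⟨(e.natAbs + v.length - e).toNat, by omega⟩
  have hval : ∀ t : unitInterval, (f.1.1 (dyadicMap (v ++ w) t) : ℝ) =
      ((b * 2 ^ k + a : ℤ) + t) / 2 ^ (c + k) := by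
    intro t
    rw [dyadicMap_append, h, hbc, ha, hw]
    have h2 : (2 : ℝ) ^ e * (2 ^ (c + k)) = 2 ^ (c + e.natAbs) * 2 ^ v.length := by
      rw [← zpow_natCast (2 : ℝ) (c + k), hk, ← zpow_add₀ two_ne_zero, ← pow_add, ← zpow_natCast]
      congr 1
      push_cast
      ring
    have h3 : (2 : ℝ) ^ e = 2 ^ (c + e.natAbs) * 2 ^ v.length / 2 ^ (c + k) := by
      rw [eq_div_iff (by positivity), h2]
    rw [h3]
    generalize (2 : ℝ) ^ (c + e.natAbs) = A at *
    have hA : A ≠ 0 := by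
      rintro rfl
      have : (0 : ℝ) < 2 ^ e * 2 ^ (c + k) := by positivity
      rw [h2, zero_mul] at this
      exact lt_irrefl _ this
    rw [pow_add (2 : ℝ) c k]
    push_cast
    field_simp
    ring
  have hpos : (0 : ℝ) < 2 ^ (c + k) := by positivity
  have h0 : 0 ≤ b * 2 ^ k + (a : ℤ) := by
    have := (f.1.1 (dyadicMap (v ++ w) 0)).2.1
    rw [hval, Icc.coe_zero, add_zero, le_div_iff₀ hpos, zero_mul] at this
    exact_mod_cast this
  have h1 : b * 2 ^ k + (a : ℤ) < 2 ^ (c + k) := by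
    have := (f.1.1 (dyadicMap (v ++ w) 1)).2.2
    rw [hval, Icc.coe_one, div_le_iff₀ hpos, one_mul] at this
    exact_mod_cast this
  obtain ⟨A, hA⟩ := Int.eq_ofNat_of_zero_le h0
  rw [hA] at h1 hval
  obtain ⟨u, -, hu⟩ := exists_word_of_lt (c + k) A (by exact_mod_cast h1)
  refine .maps (u := u) fun t => Subtype.ext ?_
  rw [hval, hu, Int.cast_natCast]

/-- Sufficiently short standard intervals have no breakpoint inside, since every breakpoint is a
multiple of their length; there `of_affine` applies. -/
theorem subdividable (f : ThompsonF) (v : List Bool) : Subdividable f v := by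
  obtain ⟨S, hS, hSd, hf⟩ := f.2
  obtain ⟨N, hN⟩ := exists_common_denominator hS hSd
  have hlong : ∀ v : List Bool, N ≤ v.length → Subdividable f v := by
    intro v hv
    obtain ⟨a, ha⟩ := exists_dyadicMap_eq v
    have hpos : (0 : ℝ) < 2 ^ v.length := by positivity
    obtain ⟨_, ⟨e, rfl⟩, he⟩ := hf (dyadicMap v 0) (dyadicMap v 1)
      (dyadicMap_strictMono v zero_lt_one) (by
        rintro s hs ⟨h1, h2⟩
        obtain ⟨m, hm⟩ := hN s hs _ hv
        have h1' : (dyadicMap v 0 : ℝ) < s := h1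
        have h2' : (s : ℝ) < dyadicMap v 1 := h2
        rw [ha, hm, Icc.coe_zero, add_zero, div_lt_div_iff_of_pos_right hpos] at h1'
        rw [ha, hm, Icc.coe_one, div_lt_div_iff_of_pos_right hpos] at h2'
        have h3 : (a : ℤ) < m := by exact_mod_cast h1'
        have h4 : m < (a : ℤ) + 1 := by exact_mod_cast h2'
        omega)
    refine .of_affine (e := e) ?_ fun t => ?_
    · refine (isDyadic_apply_iff hS hSd f.1.2.1 hf _).2 ⟨a, v.length, ?_⟩
      rw [ha]
      simp
    · rw [he _ ((dyadicMap_strictMono v).monotone unitInterval.nonneg')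
        ((dyadicMap_strictMono v).monotone unitInterval.le_one'), ha t, ha 0, Icc.coe_zero]
      simp only
      congr 2
      ring
  exact .of_extensions N fun w hw => hlong _ (by simp [hw])

theorem Subdividable.exists_mapsWord_replicate {f : ThompsonF} {v : List Bool}
    (h : Subdividable f v) : ∃ M u, MapsWord f (v ++ List.replicate M true) u := by
  induction h with
  | maps h => exact ⟨0, _, by simpa using h⟩
  | split _ _ _ ih =>
    obtain ⟨M, u, h⟩ := ih
    exact ⟨M + 1, u, by simpa [List.replicate_succ] using h⟩

/-- Follow the rightmost branch of a subdivision; as f fixes 1, the image address also consists of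
`true` only. -/
theorem exists_mapsWord_replicate (f : ThompsonF) :
    ∃ M N, MapsWord f (List.replicate M true) (List.replicate N true) := by
  obtain ⟨M, u, h⟩ := (subdividable f []).exists_mapsWord_replicate
  rw [List.nil_append] at h
  refine ⟨M, u.length, ?_⟩
  rwa [← eq_replicate_true_of_dyadicMap_one u]
  rw [← h, dyadicMap_replicate_true_one, strictMono_homeomorph_one (PL0.strictMono _)]
  rfl

/-! ### Realizing a subdivision by a product of generators. -/

/-- The comb intervals before j are already placed on pieces where f is good, and the j-th on v.
Each splitting of v is realized by composing with (xGen j)⁻¹, which halves the j-th interval and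
shifts the later ones. -/
theorem Subdividable.exists_refinement {f : ThompsonF} {v : List Bool} (hv : Subdividable f v) :
    ∀ p ∈ Subgroup.closure ({x0, x1} : Set ThompsonF), ∀ j : ℕ,
      (∀ i < j, ∃ w, MapsWord p (combWord i) w ∧ ∃ u, MapsWord f w u) →
      MapsWord p (combWord j) v →
      ∃ p' ∈ Subgroup.closure ({x0, x1} : Set ThompsonF), ∃ j' : ℕ,
        (∀ i < j', ∃ w, MapsWord p' (combWord i) w ∧ ∃ u, MapsWord f w u) ∧
        ∀ k u, MapsWord p (combWord (j + 1 + k)) u → MapsWord p' (combWord (j' + k)) u := by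
  induction hv with
  | maps h =>
    intro p hp j hi hj
    refine ⟨p, hp, j + 1, fun i hij => ?_, fun k u h => h⟩
    rcases Nat.lt_succ_iff_lt_or_eq.1 hij with h' | rfl
    · exact hi i h'
    · exact ⟨_, hj, _, h⟩
  | split _ _ ih₀ ih₁ =>
    intro p hp j hi hj
    obtain ⟨p₂, hp₂, j₂, hi₂, hk₂⟩ := ih₀ (p * (xGen j)⁻¹) (mul_mem hp (inv_mem (xGen_mem j))) j
      (fun i hij => by
        obtain ⟨w, hw, hu⟩ := hi i hij
        exact ⟨w, hw.mul (mapsWord_xGen_fix hij).inv, hu⟩)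
      ((hj.append [false]).mul (mapsWord_xGen_left j).inv)
    obtain ⟨p₃, hp₃, j₃, hi₃, hk₃⟩ := ih₁ p₂ hp₂ j₂ hi₂
      -- Once the left half is treated, the next comb interval lands on the right half of v.
      (hk₂ 0 _ ((hj.append [true]).mul (mapsWord_xGen_mid j).inv))
    refine ⟨p₃, hp₃, j₃, hi₃, fun k u h => hk₃ k u ?_⟩
    rw [add_assoc]
    refine hk₂ (1 + k) u ?_
    have := h.mul (mapsWord_xGen_comb j k).inv
    rwa [show j + 2 + k = j + 1 + (1 + k) by ring] at this

theorem exists_refinement (f : ThompsonF) (n : ℕ) :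
    ∃ p ∈ Subgroup.closure ({x0, x1} : Set ThompsonF), ∃ j : ℕ,
      (∀ i < j, ∃ w, MapsWord p (combWord i) w ∧ ∃ u, MapsWord f w u) ∧
      ∀ k, MapsWord p (combWord (j + k)) (combWord (n + k)) := by
  induction n with
  | zero => exact ⟨1, one_mem _, 0, by simp, fun k => .one _⟩
  | succ n ih =>
    obtain ⟨p, hp, j, hi, hk⟩ := ih
    obtain ⟨p', hp', j', hi', hk'⟩ :=
      (subdividable f (combWord n)).exists_refinement p hp j hi (hk 0)
    refine ⟨p', hp', j', hi', fun k => hk' k _ ?_⟩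
    rw [add_assoc, add_assoc]
    exact hk (1 + k)

/-! ### Pushing the images back onto the comb; generation of F. -/

/-- The element `q` maps each interval of the comb subdivision onto a standard dyadic interval,
fixes the first `i` of them pointwise, and shifts those from the `j`-th on. -/
structure CombState (q : ThompsonF) (i j : ℕ) : Prop where
  fix : ∀ l < i, MapsWord q (combWord l) (combWord l)
  maps : ∀ l, ∃ u, MapsWord q (combWord l) u
  tail : ∃ n, ∀ k, MapsWord q (combWord (j + k)) (combWord (n + k))

namespace CombState

variable {q : ThompsonF} {i j : ℕ}

theorem apply_start (h : CombState q i j) :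
    q.1.1 (dyadicMap (combWord i) 0) = dyadicMap (combWord i) 0 := by
  cases i with
  | zero =>
    have : dyadicMap (combWord 0) 0 = 0 := by
      apply Subtype.ext
      simp [combWord, coe_dyadicMap_false, dyadicMap_nil]
    rw [this, strictMono_homeomorph_zero (PL0.strictMono _)]
  | succ i => rw [← dyadicMap_combWord_one, h.fix i (Nat.lt_succ_self i)]

/-- Fixing the earlier intervals fixes the left endpoint of the i-th; a standard interval starting
there and ending before 1 is an initial piece of it. -/
theorem exists_replicate (h : CombState q i j) :
    ∃ m, MapsWord q (combWord i) (combWord i ++ List.replicate m false) := by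
  obtain ⟨u, hu⟩ := h.maps i
  obtain ⟨m, rfl⟩ := exists_eq_combWord_append (i := i) (u := u)
    (by rw [← hu 0, h.apply_start]) (by
      rw [← hu 1]
      have h1 : dyadicMap (combWord i) 1 < 1 := by
        rw [dyadicMap_combWord_one]
        exact dyadicMap_zero_lt_one _
      have := PL0.strictMono q.1 h1
      rw [strictMono_homeomorph_one (PL0.strictMono _)] at this
      exact this)
  exact ⟨m, hu⟩

/-- xᵢ strips one `false` from the i-th image. The other images lie in the earlier comb intervals or
start strictly further right, so xᵢ maps them to standard intervals too. -/
theorem mul_xGen (h : CombState q i j) (hij : i < j) {m : ℕ}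
    (hm : MapsWord q (combWord i) (combWord i ++ List.replicate (m + 1) false)) :
    CombState (xGen i * q) i j ∧
      MapsWord (xGen i * q) (combWord i) (combWord i ++ List.replicate m false) := by
  have hmi : MapsWord (xGen i * q) (combWord i) (combWord i ++ List.replicate m false) := by
    refine ((mapsWord_xGen_left i).append (List.replicate m false)).mul ?_
    simpa [List.replicate_succ] using hm
  have hlt : ∀ l u, i < l → MapsWord q (combWord l) u →
      dyadicMap (combWord i) 0 < dyadicMap u 0 := by
    intro l u hl hu
    rw [← hu 0, ← h.apply_start]
    exact PL0.strictMono _ (strictMono_combWord hl)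
  refine ⟨⟨fun l hl => (mapsWord_xGen_fix hl).mul (h.fix l hl), fun l => ?_, ?_⟩, hmi⟩
  · rcases lt_trichotomy l i with hl | rfl | hl
    · exact ⟨_, (mapsWord_xGen_fix hl).mul (h.fix l hl)⟩
    · exact ⟨_, hmi⟩
    · obtain ⟨u, hu⟩ := h.maps l
      obtain ⟨w, rfl | rfl | rfl⟩ := exists_append_of_dyadicMap_combWord_lt (hlt l u hl hu)
      · refine ⟨_, ((mapsWord_xGen_left i).append w).mul ?_⟩
        simpa using hu
      · refine ⟨_, ((mapsWord_xGen_mid i).append w).mul ?_⟩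
        simpa using hu
      · refine ⟨_, ((mapsWord_xGen_right i).append w).mul ?_⟩
        simpa using hu
  · obtain ⟨n, hn⟩ := h.tail
    have hin : i < n := strictMono_combWord.lt_iff_lt.1 (hlt j _ hij (hn 0))
    obtain ⟨d, rfl⟩ := Nat.exists_eq_add_of_lt hin
    refine ⟨i + d + 2, fun k => ?_⟩
    have h1 := mapsWord_xGen_comb i (d + k)
    rw [show i + 1 + (d + k) = i + d + 1 + k by ring,
      show i + 2 + (d + k) = i + d + 2 + k by ring] at h1
    exact h1.mul (hn k)

theorem exists_step (h : CombState q i j) (hij : i < j) :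
    ∃ g ∈ Subgroup.closure ({x0, x1} : Set ThompsonF), CombState (g * q) (i + 1) j := by
  obtain ⟨m, hm⟩ := h.exists_replicate
  induction m generalizing q with
  | zero =>
    refine ⟨1, one_mem _, ?_⟩
    rw [one_mul]
    refine ⟨fun l hl => ?_, h.maps, h.tail⟩
    rcases Nat.lt_succ_iff_lt_or_eq.1 hl with h' | rfl
    · exact h.fix l h'
    · simpa using hm
  | succ m ih =>
    obtain ⟨h', hm'⟩ := h.mul_xGen hij hm
    obtain ⟨g, hg, hs⟩ := ih h' hm'
    exact ⟨g * xGen i, mul_mem hg (xGen_mem i), by rwa [mul_assoc]⟩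

theorem exists_normalize (h : CombState q 0 j) (hij : i ≤ j) :
    ∃ g ∈ Subgroup.closure ({x0, x1} : Set ThompsonF), CombState (g * q) i j := by
  induction i with
  | zero => exact ⟨1, one_mem _, by rwa [one_mul]⟩
  | succ i ih =>
    obtain ⟨g, hg, hs⟩ := ih (by omega)
    obtain ⟨g', hg', hs'⟩ := hs.exists_step hij
    exact ⟨g' * g, mul_mem hg' hg, by rwa [mul_assoc]⟩

theorem eq_one (h : CombState q j j) : q = 1 := by
  obtain ⟨n, hn⟩ := h.tail
  -- With all earlier intervals fixed, the tail has no room to shift.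
  obtain rfl : n = j := by
    have := hn 0 0
    rw [add_zero, add_zero, h.apply_start] at this
    exact (strictMono_combWord.injective this).symm
  have hfix : ∀ l, MapsWord q (combWord l) (combWord l) := by
    intro l
    rcases lt_or_ge l n with hl | hl
    · exact h.fix l hl
    · obtain ⟨k, rfl⟩ := Nat.exists_eq_add_of_le hl
      exact hn k
  refine Subtype.ext (Subtype.ext (Homeomorph.ext fun t => ?_))
  change q.1.1 t = t
  rcases (unitInterval.le_one' : t ≤ 1).eq_or_lt with rfl | ht
  · exact strictMono_homeomorph_one (PL0.strictMono _)
  · obtain ⟨l, s, rfl⟩ := exists_mem_combWord ht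
    exact hfix l s

end CombState

theorem closure_x0_x1 : Subgroup.closure ({x0, x1} : Set ThompsonF) = ⊤ := by
  rw [eq_top_iff]
  rintro f -
  obtain ⟨M, N, hMN⟩ := exists_mapsWord_replicate f
  -- Only the first M comb intervals need subdividing: beyond them f replaces the prefix of M
  -- `true`s and so shifts the comb.
  obtain ⟨p, hp, j, hi, hk⟩ := exists_refinement f M
  have htail : ∀ k, MapsWord (f * p) (combWord (j + k)) (combWord (N + k)) := fun k => by
    have h := hMN.append (combWord k)
    rw [replicate_append_combWord, replicate_append_combWord] at h
    exact h.mul (hk k)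
  have hs : CombState (f * p) 0 j := by
    refine ⟨by simp, fun l => ?_, N, htail⟩
    rcases lt_or_ge l j with hl | hl
    · obtain ⟨w, hw, u, hu⟩ := hi l hl
      exact ⟨u, hu.mul hw⟩
    · obtain ⟨k, rfl⟩ := Nat.exists_eq_add_of_le hl
      exact ⟨_, htail k⟩
  obtain ⟨g, hg, hs'⟩ := hs.exists_normalize le_rfl
  have e := hs'.eq_one
  have : f = g⁻¹ * p⁻¹ := by
    rw [eq_mul_inv_iff_mul_eq]
    exact eq_inv_of_mul_eq_one_right e
  rw [this]
  exact mul_mem (inv_mem hg) (inv_mem hp)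

theorem mainTheorem6 (f₀ f₁ : PL0)
    (hncomm : f₀ * f₁ ≠ f₁ * f₀)
    (horb : ∀ a c b d : unitInterval, IsOrbital f₀ a c → IsOrbital f₁ b d →
      Set.Ioo b d ⊆ Set.Ioo a c ∨ Set.Ioo a c ∩ Set.Ioo b d = ∅)
    (hup : ∀ a c : unitInterval, IsUpBump f₀ a c →
      ∃ (n : ℕ) (b d : Fin (n + 1) → unitInterval),
        IsOrbitalList f₁ a c b d ∧ NiceUp f₀ f₁ a c b d)
    (hdown : ∀ a c : unitInterval, IsDownBump f₀ a c →
      ∃ (n : ℕ) (b d : Fin (n + 1) → unitInterval),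
        IsOrbitalList f₁ a c b d ∧ NiceDown f₀ f₁ a c b d) :
    GeneratesStandardCopy f₀ f₁ := by
  refine thompsonRel_x0_x1.exists_mulEquiv (PL0.thompsonRel_of_relAt fun x => ?_)
    not_commute_x0_x1 hncomm closure_x0_x1
  by_cases hx : f₀.1 x = x
  · have h1 := PL0.fixed_of_nested horb hx
    -- Nesting is used twice, to keep both f₁ x and f₁ (f₁ x) fixed by `f₀`.
    exact PL0.relAt_of_fixed hx h1 (PL0.fixed_of_nested horb h1)
  · obtain ⟨a, c, hac, hmem⟩ := exists_isOrbital f₀ hx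
    rcases hac.isUpBump_or_isDownBump with h | h
    · obtain ⟨n, b, d, hl, hnice⟩ := hup a c h
      exact hl.relAt_of_isUpBump horb h hnice (Ioo_subset_Icc_self hmem)
    · obtain ⟨n, b, d, hl, hnice⟩ := hdown a c h
      exact hl.relAt_of_isDownBump horb h hnice (Ioo_subset_Icc_self hmem)
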